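/- Let $N$ be a closed (compact, connected, without boundary) smooth Riemannian manifold, and let $\pi:\tilde N\to N$ be its universal cover, with the Riemannian metric for which $\pi$ is a local isometry. For a smooth simple closed curve $\gamma$ in $\tilde N$ (an injective smooth map $\gamma:S^1\to\tilde N$) and a subset $S\subseteq\tilde N$, say that $\gamma$ bounds a disc in $S$ if $\gamma$ extends to a continuous map from the closed unit disc to $S$. Put $N_r(\gamma)=\{x\in\tilde N: d(x,\gamma)\le r\}$ and $$\operatorname{fill\,rad}(\gamma)=\sup\{r\ge 0:\ \gamma\text{ does not bound a disc in }N_r(\gamma)\}.$$ Suppose that there is a constant $C<\infty$ such that $\operatorname{fill\,rad}(\gamma)\le C$ for every smooth simple closed curve $\gamma$ in $\tilde N$ that bounds a disc in $\tilde N$. Then no finitely generated subgroup $G$ of $\pi_1(N)$ has exactly one end. Here the number of ends of a finitely generated group $G$ is the number of topological ends of $\tilde K$, where $\tilde K\to K$ is any connected regular covering of a finite simplicial complex $K$ whose group of covering transformations is isomorphic to $G$. The topological ends of $\tilde K$ are the elements of the inverse limit of the sets of connected components of $\tilde K\setminus B$, over the compact subsets $B\subseteq\tilde K$. -/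

import Mathlib

open Set Bundle Manifold TopologicalSpace
open scoped ContDiff ENNReal NNReal

noncomputable section

namespace FillRad

section Ends

/-- The topological (Freudenthal) ends of a space `X`: compatible choices, for every compact
`K ⊆ X`, of a connected component of `X \ K`; that is, the inverse limit of the sets of components
of the complements of the compact subsets of `X`. -/
def TopEnd (X : Type*) [TopologicalSpace X] : Type _ :=
  {ε : Compacts X → Set X //
    (∀ K : Compacts X, ∃ x ∈ (K : Set X)ᶜ, ε K = connectedComponentIn (K : Set X)ᶜ x) ∧
    ∀ K L : Compacts X, K ≤ L → ε L ⊆ ε K}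

/-- The group of covering (deck) transformations of `q : X → B`. -/
def deckGroup {X B : Type*} [TopologicalSpace X] (q : X → B) : Subgroup (X ≃ₜ X) where
  carrier := {f | ∀ x, q (f x) = q x}
  mul_mem' := fun {f g} hf hg x => (hf (g x)).trans (hg x)
  one_mem' := fun _ => rfl
  inv_mem' := fun {f} hf x => by
    have h := hf (f⁻¹ x)
    have h' : f (f⁻¹ x) = x := f.apply_symm_apply x
    rw [h'] at h
    exact h.symm

/-- A regular covering: a surjective covering map whose deck transformations act transitively on
every fibre. -/
def IsRegularCovering {X B : Type*} [TopologicalSpace X] [TopologicalSpace B] (q : X → B) : Prop :=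
  IsCoveringMap q ∧ Function.Surjective q ∧
    ∀ x y, q x = q y → ∃ f ∈ deckGroup q, f x = y

/-- `HasNumEnds G k` says that the group `G` has `k` ends (`k ∈ {0, 1, 2, …, ∞}`): the space `X` of
some connected regular covering of (the underlying space of) a finite simplicial complex, with group
of covering transformations isomorphic to `G`, has exactly `k` topological ends. Such coverings
exist exactly for finitely generated `G`, and the number of ends does not depend on the choice.
A connected covering of a finite complex has at most the cardinality of the continuum, so that
nothing is lost by taking `X` in the lowest universe. -/
def HasNumEnds (G : Type*) [Group G] (k : ℕ∞) : Prop :=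
  ∃ (m : ℕ) (K : Geometry.SimplicialComplex ℝ (EuclideanSpace ℝ (Fin m))) (X : Type)
    (_ : TopologicalSpace X) (q : X → K.space),
    K.faces.Finite ∧ ConnectedSpace X ∧ IsRegularCovering q ∧
    Nonempty (G ≃* deckGroup q) ∧ ENat.card (TopEnd X) = k

end Ends

section FillRadius

variable {E : Type*} [NormedAddCommGroup E] [NormedSpace ℝ E]
  {H : Type*} [TopologicalSpace H] (I : ModelWithCorners ℝ E H)
  {M : Type*}

/-- A smooth simple closed curve in `M`, parametrized as a smooth map on `ℝ` of period `1` that is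
injective on a period. -/
def IsSmoothSimpleClosedCurve [TopologicalSpace M] [ChartedSpace H M] (γ : ℝ → M) : Prop :=
  ContMDiff 𝓘(ℝ, ℝ) I ∞ γ ∧ Function.Periodic γ 1 ∧ InjOn γ (Ico 0 1)

/-- The closed curve `γ` (of period `1`) bounds a disc in `S`: there is a continuous map of the
closed unit disc into `S` whose restriction to the unit circle is `γ`. -/
def BoundsDiscIn [TopologicalSpace M] (γ : ℝ → M) (S : Set M) : Prop :=
  ∃ f : ℂ → M, ContinuousOn f (Metric.closedBall 0 1) ∧ MapsTo f (Metric.closedBall 0 1) S ∧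
    ∀ t : ℝ, f (Complex.exp (2 * Real.pi * t * Complex.I)) = γ t

/-- The fill radius of a closed curve `γ` in a manifold without boundary: the supremum of all
`r ≥ 0` such that `γ` does not bound a disc in `{x | d(x, γ) ≤ r}`. -/
def fillRadius [EMetricSpace M] (γ : ℝ → M) : ℝ≥0∞ :=
  ⨆ (r : ℝ≥0) (_ : ¬ BoundsDiscIn γ (Metric.cthickening (r : ℝ) (range γ))), (r : ℝ≥0∞)

variable (M) in
/-- The fill radius of the manifold `M` (without boundary) is bounded: for some finite `C`, every
smooth simple closed curve that bounds a disc in `M` has fill radius at most `C`. -/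
def HasBoundedFillRadius [EMetricSpace M] [ChartedSpace H M] : Prop :=
  ∃ C : ℝ≥0, ∀ γ : ℝ → M, IsSmoothSimpleClosedCurve I γ → BoundsDiscIn γ univ →
    fillRadius γ ≤ C

/-- A map of Riemannian manifolds that is smooth and whose derivative at every point preserves the
Riemannian norms. (Between manifolds of the same dimension: a local isometry.) -/
def IsLocalRiemannianIsometry {M' : Type*} [TopologicalSpace M] [ChartedSpace H M]
    [TopologicalSpace M'] [ChartedSpace H M']
    [RiemannianBundle (fun x : M => TangentSpace I x)]
    [RiemannianBundle (fun x : M' => TangentSpace I x)] (p : M → M') : Prop :=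
  ContMDiff I I ∞ p ∧ ∀ (x : M) (v : TangentSpace I x), ‖mfderiv I I p x v‖ = ‖v‖

end FillRadius

end FillRad

end

/-! Suppose a finitely generated subgroup `G` of the fundamental group has one end. It acts on the
universal cover by deck transformations, and an orbit map `o : G → M` is a coarse embedding:
generators move the base point a bounded amount, while orbit points at bounded distance differ by a
bounded word length, because bounded sets of the cover are relatively compact and the action is
properly discontinuous.

One-endedness of a covering space passes to the group (`exists_forall_reflTransGen_stepOutside`):
elements far from `1` are joined by chains of generators avoiding any prescribed ball. Take a long
geodesic of `G` with midpoint `1`, and join its ends by a chain far from `1`. Thickening both chains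
in `M` and choosing smooth arcs inside gives an arc `α` along the geodesic and an arc `β` far from
its midpoint. They may intersect, but only far from the middle, so a subarc of `α` crossing the
middle and a subarc of `β` form a smooth simple closed curve (`exists_crossing_curve`).

This curve bounds a disc, since `M` is simply connected. It bounds none near itself: let `P` and `V`
be continuous approximations of the signed position along the geodesic and of the word length.
Truncating `P` to `[-1/2, 1/2]` where `V` is small, and taking the point `1/2` elsewhere, defines a
continuous map to `ℝ/ℤ` near the two chains, because there a large `V` along the geodesic forces a
large `|P|`. On the curve this map winds once, whereas it has degree zero on the boundary of a disc
(`BoundsDiscIn.lift_eq`). As the size of the neighbourhood is arbitrary, the fill radius is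
unbounded (`not_hasBoundedFillRadius`). -/

namespace FillRad

open Filter Topology

/-! ### Ends and components of complements of compact sets -/

section EndsOfSpaces

variable {X : Type*} [TopologicalSpace X]

/-- Outside some compact set, only finitely many components of the complement of a compact set
are met. -/
theorem exists_finite_components [LocallyCompactSpace X] [T2Space X] [LocallyConnectedSpace X]
    [PreconnectedSpace X] {K : Set X} (hK : IsCompact K) :
    ∃ K₁ : Set X, IsCompact K₁ ∧ K ⊆ K₁ ∧
      {C | ∃ x ∉ K₁, C = connectedComponentIn Kᶜ x}.Finite := by
  rcases K.eq_empty_or_nonempty with rfl | hne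
  · refine ⟨∅, isCompact_empty, subset_rfl, (finite_singleton (univ : Set X)).subset ?_⟩
    rintro C ⟨x, -, rfl⟩
    simp [connectedComponentIn_univ, PreconnectedSpace.connectedComponent_eq_univ]
  obtain ⟨K₁, hK₁, hKK₁⟩ := exists_compact_superset hK
  refine ⟨K₁, hK₁, hKK₁.trans interior_subset, ?_⟩
  have hopen : ∀ y, IsOpen (connectedComponentIn Kᶜ y) := fun y =>
    hK.isClosed.isOpen_compl.connectedComponentIn
  have hfr : frontier K₁ ⊆ Kᶜ := fun y hy hyK => hy.2 (hKK₁ hyK)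
  have hcf : IsCompact (frontier K₁) :=
    hK₁.of_isClosed_subset isClosed_frontier hK₁.isClosed.frontier_subset
  obtain ⟨t, ht⟩ := hcf.elim_finite_subcover (fun y : frontier K₁ => connectedComponentIn Kᶜ y.1)
    (fun y => hopen _) fun y hy => mem_iUnion.2 ⟨⟨y, hy⟩, mem_connectedComponentIn (hfr hy)⟩
  refine (t.finite_toSet.image fun y => connectedComponentIn Kᶜ y.1).subset ?_
  rintro C ⟨x, hx, rfl⟩
  have hxK : x ∈ Kᶜ := fun h => hx (interior_subset (hKK₁ h))
  -- A component missing the frontier would lie outside `K₁`, hence be clopen in `X` and equal to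
  -- it, contradicting `K` nonempty. So each such component is one of the finitely many covering the
  -- compact frontier.
  have hmeet : (connectedComponentIn Kᶜ x ∩ frontier K₁).Nonempty := by
    by_contra hemp
    rw [not_nonempty_iff_eq_empty] at hemp
    have hsub : connectedComponentIn Kᶜ x ⊆ interior K₁ ∪ K₁ᶜ := by
      intro y hy
      by_cases hyK : y ∈ K₁
      · left
        by_contra hyi
        exact (hemp ▸ (⟨hy, subset_closure hyK, hyi⟩ :
          y ∈ connectedComponentIn Kᶜ x ∩ frontier K₁) : y ∈ (∅ : Set X))
      · exact Or.inr hyK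
    have hout : connectedComponentIn Kᶜ x ⊆ K₁ᶜ := by
      rcases IsPreconnected.subset_or_subset isOpen_interior hK₁.isClosed.isOpen_compl
        (disjoint_compl_right.mono_left interior_subset) hsub
        isPreconnected_connectedComponentIn with h | h
      · exact absurd (interior_subset (h (mem_connectedComponentIn hxK))) hx
      · exact h
    have hcl : closure (connectedComponentIn Kᶜ x) ⊆ connectedComponentIn Kᶜ x := by
      refine isPreconnected_connectedComponentIn.closure.subset_connectedComponentIn
        (subset_closure (mem_connectedComponentIn hxK)) ?_
      have h1 : closure (connectedComponentIn Kᶜ x) ⊆ (interior K₁)ᶜ :=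
        closure_minimal (hout.trans (compl_subset_compl.2 interior_subset))
          isOpen_interior.isClosed_compl
      exact h1.trans (compl_subset_compl.2 hKK₁)
    have huniv : connectedComponentIn Kᶜ x = univ :=
      IsClopen.eq_univ ⟨isClosed_of_closure_subset hcl, hopen x⟩
        ⟨x, mem_connectedComponentIn hxK⟩
    obtain ⟨k, hk⟩ := hne
    exact connectedComponentIn_subset Kᶜ x (huniv ▸ mem_univ k) hk
  obtain ⟨y, hy, hyf⟩ := hmeet
  obtain ⟨z, hz, hyz⟩ := mem_iUnion₂.1 (ht hyf)
  exact ⟨z, hz, (connectedComponentIn_eq hyz).trans (connectedComponentIn_eq hy).symm⟩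

/-- An ultrafilter leaving every compact set converges to an end. -/
theorem exists_topEnd_of_ultrafilter [LocallyCompactSpace X] [T2Space X] [LocallyConnectedSpace X]
    [PreconnectedSpace X] (U : Ultrafilter X) (hU : (U : Filter X) ≤ cocompact X) :
    ∃ ε : TopEnd X, ∀ K, ε.1 K ∈ U := by
  have hex : ∀ K : Compacts X, ∃ C : Set X, C ∈ U ∧
      ∃ x ∈ (K : Set X)ᶜ, C = connectedComponentIn (K : Set X)ᶜ x := by
    intro K
    obtain ⟨K₁, hK₁, hKK₁, hfin⟩ := exists_finite_components K.isCompact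
    have hmem : (⋃ C ∈ {C | ∃ x ∉ K₁, C = connectedComponentIn (K : Set X)ᶜ x}, C) ∈ U := by
      refine mem_of_superset (hU hK₁.compl_mem_cocompact) fun x hx => ?_
      exact mem_iUnion₂.2 ⟨_, ⟨x, hx, rfl⟩, mem_connectedComponentIn fun h => hx (hKK₁ h)⟩
    obtain ⟨C, ⟨x, hx, rfl⟩, hCU⟩ := (Ultrafilter.finite_biUnion_mem_iff hfin).1 hmem
    exact ⟨_, hCU, x, fun h => hx (hKK₁ h), rfl⟩
  choose ε hε hε' using hex
  refine ⟨⟨ε, hε', fun K L hKL => ?_⟩, hε⟩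
  obtain ⟨x, hx, hxε⟩ := hε' K
  obtain ⟨y, hy, hyε⟩ := hε' L
  -- Two chosen components both lie in the ultrafilter, so they share a point; this forces
  -- compatibility.
  obtain ⟨z, hzK, hzL⟩ := U.nonempty_of_mem (inter_mem (hε K) (hε L))
  rw [hxε] at hzK ⊢
  rw [hyε] at hzL ⊢
  rw [connectedComponentIn_eq hzK, connectedComponentIn_eq hzL]
  exact connectedComponentIn_mono z (compl_subset_compl.2 hKL)

/-- In a space with a unique end, the complement of a compact set has only one component that
is not relatively compact. -/
theorem exists_compact_component_eq [LocallyCompactSpace X] [T2Space X] [LocallyConnectedSpace X]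
    [PreconnectedSpace X] (h1 : ENat.card (TopEnd X) = 1) {K : Set X} (hK : IsCompact K) :
    ∃ L : Set X, IsCompact L ∧ K ⊆ L ∧
      ∀ x ∉ L, ∀ y ∉ L, connectedComponentIn Kᶜ x = connectedComponentIn Kᶜ y := by
  obtain ⟨hu⟩ := ENat.card_eq_one_iff_unique.1 h1
  obtain ⟨K₁, hK₁, hKK₁, hfin⟩ := exists_finite_components hK
  set 𝒞 := {C | ∃ x ∉ K₁, C = connectedComponentIn Kᶜ x}
  -- A component that is not relatively compact carries an ultrafilter leaving all compact sets,
  -- hence an end that selects it. The remaining components are absorbed into `L`.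
  have hbig : ∀ x, (𝓟 (connectedComponentIn Kᶜ x) ⊓ cocompact X).NeBot →
      ∃ ε : TopEnd X, x ∈ Kᶜ → ε.1 ⟨K, hK⟩ = connectedComponentIn Kᶜ x := by
    intro x hx
    let U := Ultrafilter.of (𝓟 (connectedComponentIn Kᶜ x) ⊓ cocompact X)
    have hU : (U : Filter X) ≤ 𝓟 (connectedComponentIn Kᶜ x) ⊓ cocompact X := Ultrafilter.of_le _
    obtain ⟨ε, hε⟩ := exists_topEnd_of_ultrafilter U (hU.trans inf_le_right)
    refine ⟨ε, fun hxK => ?_⟩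
    obtain ⟨y, hy, hyε⟩ := ε.2.1 ⟨K, hK⟩
    obtain ⟨z, hz1, hz2⟩ := U.nonempty_of_mem (inter_mem (hε ⟨K, hK⟩)
      (hU.trans inf_le_left (mem_principal_self _)))
    rw [hyε] at hz1 ⊢
    exact (connectedComponentIn_eq hz1).trans (connectedComponentIn_eq hz2).symm
  have hsmall : ∀ C : Set X, ∃ B : Set X, IsCompact B ∧
      (¬ (𝓟 C ⊓ cocompact X).NeBot → C ⊆ B) := by
    intro C
    by_cases hC : (𝓟 C ⊓ cocompact X).NeBot
    · exact ⟨∅, isCompact_empty, fun h => absurd hC h⟩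
    · have : Cᶜ ∈ cocompact X := by
        rw [not_neBot, inf_comm, inf_principal_eq_bot] at hC
        exact hC
      obtain ⟨t, ht, htC⟩ := mem_cocompact.1 this
      exact ⟨t, ht, fun _ => compl_subset_compl.1 htC⟩
  choose B hB hCB using hsmall
  refine ⟨K₁ ∪ ⋃ C ∈ 𝒞, B C, hK₁.union (hfin.isCompact_biUnion fun C _ => hB C),
    hKK₁.trans subset_union_left, ?_⟩
  have key : ∀ x ∉ K₁ ∪ ⋃ C ∈ 𝒞, B C,
      (𝓟 (connectedComponentIn Kᶜ x) ⊓ cocompact X).NeBot ∧ x ∈ Kᶜ := by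
    intro x hx
    rw [mem_union, not_or] at hx
    have hxK : x ∈ Kᶜ := fun h => hx.1 (hKK₁ h)
    refine ⟨?_, hxK⟩
    by_contra hn
    exact hx.2 (mem_iUnion₂.2 ⟨_, ⟨x, hx.1, rfl⟩, hCB _ hn (mem_connectedComponentIn hxK)⟩)
  intro x hx y hy
  obtain ⟨ε, hε⟩ := hbig x (key x hx).1
  obtain ⟨ε', hε'⟩ := hbig y (key y hy).1
  rw [← hε (key x hx).2, ← hε' (key y hy).2, Subsingleton.elim ε ε']

/-- In a compact space an end would have to choose a component of the empty complement of the whole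
space. -/
theorem noncompactSpace_of_nonempty_topEnd (h : Nonempty (TopEnd X)) : NoncompactSpace X := by
  rw [← not_compactSpace_iff]
  intro hc
  obtain ⟨ε⟩ := h
  obtain ⟨x, hx, -⟩ := ε.2.1 ⊤
  exact hx trivial

end EndsOfSpaces

/-! ### Local topology of finite complexes -/

section FiniteComplex

variable {E : Type*} [NormedAddCommGroup E] [NormedSpace ℝ E]

/-- A finite union of closed convex sets is locally connected. -/
theorem locallyConnectedSpace_biUnion_convex {ι : Type*} {s : Set ι} (hs : s.Finite)
    {C : ι → Set E} (hC : ∀ i ∈ s, IsClosed (C i)) (hconv : ∀ i ∈ s, Convex ℝ (C i)) :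
    LocallyConnectedSpace (⋃ i ∈ s, C i : Set E) := by
  rw [locallyConnectedSpace_iff_connected_subsets]
  rintro ⟨x, hx⟩ U hU
  obtain ⟨V, hV, hVU⟩ := mem_nhds_subtype _ _ _ |>.1 hU
  -- A small ball around `x` meets only the pieces containing `x`, so its trace on the union is
  -- star-shaped about `x`.
  have hfar : (⋃ i ∈ {i ∈ s | x ∉ C i}, C i)ᶜ ∈ 𝓝 x := by
    refine IsClosed.compl_mem_nhds ?_ ?_
    · exact (hs.subset fun i hi => hi.1).isClosed_biUnion fun i hi => hC i hi.1
    · simp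
  obtain ⟨r, hr, hball⟩ := Metric.mem_nhds_iff.1 (inter_mem hV hfar)
  refine ⟨Subtype.val ⁻¹' Metric.ball x r, ?_, ?_, fun y hy => hVU (hball hy).1⟩
  · exact continuous_subtype_val.continuousAt.preimage_mem_nhds (Metric.ball_mem_nhds x hr)
  · have hstar : StarConvex ℝ x (Metric.ball x r ∩ ⋃ i ∈ s, C i) := by
      intro y hy a b ha hb hab
      obtain ⟨hyr, hyC⟩ := hy
      obtain ⟨i, hi, hyi⟩ := mem_iUnion₂.1 hyC
      have hxi : x ∈ C i := by
        by_contra hxi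
        exact (hball hyr).2 (mem_iUnion₂.2 ⟨i, ⟨hi, hxi⟩, hyi⟩)
      exact ⟨convex_ball x r (Metric.mem_ball_self hr) hyr ha hb hab,
        mem_iUnion₂.2 ⟨i, hi, hconv i hi hxi hyi ha hb hab⟩⟩
    have hpc := (hstar.isPathConnected ⟨Metric.mem_ball_self hr, hx⟩).isConnected.isPreconnected
    rw [← Topology.IsInducing.subtypeVal.isPreconnected_image, Subtype.image_preimage_coe]
    rwa [inter_comm] at hpc

theorem simplicialComplex_compactSpace (K : Geometry.SimplicialComplex ℝ E)
    (hK : K.faces.Finite) : CompactSpace K.space := by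
  rw [← isCompact_iff_compactSpace]
  exact hK.isCompact_biUnion fun s _ => s.finite_toSet.isCompact_convexHull ℝ

theorem simplicialComplex_locallyConnectedSpace (K : Geometry.SimplicialComplex ℝ E)
    (hK : K.faces.Finite) : LocallyConnectedSpace K.space :=
  locallyConnectedSpace_biUnion_convex hK
    (fun s _ => (s.finite_toSet.isCompact_convexHull ℝ).isClosed)
    fun _ _ => convex_convexHull ℝ _

end FiniteComplex

/-! ### Word length and geodesics in a finitely generated group -/

section WordLength

variable {G : Type*} [Group G]

/-- `ℓ` behaves like the word length with respect to a finite symmetric generating set. -/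
structure IsWordLength (ℓ : G → ℕ) : Prop where
  one : ℓ 1 = 0
  mul_le : ∀ g h, ℓ (g * h) ≤ ℓ g + ℓ h
  inv : ∀ g, ℓ g⁻¹ = ℓ g
  finite_ball : ∀ n, {g | ℓ g ≤ n}.Finite
  exists_pred : ∀ n g, ℓ g = n + 1 → ∃ h s, g = h * s ∧ ℓ h = n ∧ ℓ s ≤ 1

open Pointwise in
theorem exists_isWordLength [Group.FG G] : ∃ ℓ : G → ℕ, IsWordLength ℓ := by
  classical
  obtain ⟨S, hS⟩ := Group.fg_def.1 ‹Group.FG G›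
  let A : Finset G := S ∪ S⁻¹ ∪ {1}
  have h1A : (1 : G) ∈ A := by simp [A]
  have hinvA : A⁻¹ = A := by
    ext g
    simp only [A, Finset.mem_inv', Finset.mem_union, Finset.mem_singleton, inv_inv, inv_eq_one]
    tauto
  have hpow : ∀ (n : ℕ) (g : G), g ∈ A ^ n → g⁻¹ ∈ A ^ n := fun n g hg => by
    rw [← hinvA, inv_pow]
    exact Finset.inv_mem_inv hg
  have hex : ∀ g : G, ∃ n : ℕ, g ∈ A ^ n := by
    intro g
    have hg : g ∈ Subgroup.closure (S : Set G) := hS ▸ Subgroup.mem_top g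
    induction hg using Subgroup.closure_induction with
    | mem x hx => exact ⟨1, by simp [A, Finset.mem_coe.1 hx]⟩
    | one => exact ⟨0, by simp⟩
    | mul x y _ _ hx hy =>
      obtain ⟨m, hm⟩ := hx
      obtain ⟨n, hn⟩ := hy
      exact ⟨m + n, by rw [pow_add]; exact Finset.mul_mem_mul hm hn⟩
    | inv x _ hx =>
      obtain ⟨m, hm⟩ := hx
      exact ⟨m, hpow m x hm⟩
  -- Since `1 ∈ A` the powers of `A` increase, so they are exactly the balls.
  have hle : ∀ {g n}, Nat.find (hex g) ≤ n ↔ g ∈ A ^ n := fun {g n} =>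
    ⟨fun h => Finset.pow_subset_pow_right h1A h (Nat.find_spec (hex g)), fun h => Nat.find_min' _ h⟩
  have hinv : ∀ g, Nat.find (hex g⁻¹) ≤ Nat.find (hex g) := fun g =>
    hle.2 (hpow _ _ (Nat.find_spec (hex g)))
  refine ⟨fun g => Nat.find (hex g), ?_, ?_, ?_, ?_, ?_⟩
  · exact Nat.le_zero.1 (hle.2 (by simp))
  · intro g h
    rw [hle, pow_add]
    exact Finset.mul_mem_mul (Nat.find_spec (hex g)) (Nat.find_spec (hex h))
  · intro g
    exact le_antisymm (hinv g) (by simpa using hinv g⁻¹)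
  · intro n
    exact (A ^ n).finite_toSet.subset fun g hg => hle.1 hg
  · intro n g hg
    have hg' : g ∈ A ^ (n + 1) := hle.1 hg.le
    rw [pow_succ] at hg'
    obtain ⟨h, hh, s, hs, rfl⟩ := Finset.mem_mul.1 hg'
    have hsA : s ∈ A ^ 1 := by simpa using hs
    refine ⟨h, s, rfl, le_antisymm (hle.2 hh) ?_, hle.2 hsA⟩
    by_contra! hlt
    have h1 : h * s ∈ A ^ (Nat.find (hex h) + 1) := by
      rw [pow_succ]
      exact Finset.mul_mem_mul (Nat.find_spec (hex h)) hs
    have := hle.2 h1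
    omega

namespace IsWordLength

variable {ℓ : G → ℕ}

/-- Every element is the end of a geodesic from the identity. -/
theorem exists_geodesic (hℓ : IsWordLength ℓ) (n : ℕ) : ∀ g, ℓ g = n →
    ∃ v : ℕ → G, v n = g ∧ (∀ i ≤ n, ℓ (v i) = i) ∧
      ∀ i j, i ≤ j → j ≤ n → ℓ ((v i)⁻¹ * v j) ≤ j - i := by
  induction n with
  | zero =>
    intro g hg
    refine ⟨fun _ => g, rfl, fun i hi => by simp [hg, Nat.le_zero.1 hi], fun i j _ _ => ?_⟩
    simp [hℓ.one]
  | succ n ih =>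
    intro g hg
    obtain ⟨h, s, rfl, hh, hs⟩ := hℓ.exists_pred n g hg
    obtain ⟨v, hv, hvℓ, hvd⟩ := ih h hh
    have hlt : ∀ i ≤ n, Function.update v (n + 1) (h * s) i = v i := fun i hi =>
      Function.update_of_ne (by omega) _ _
    refine ⟨Function.update v (n + 1) (h * s), by simp, fun i hi => ?_, fun i j hij hj => ?_⟩
    · rcases Nat.lt_or_ge n i with hi' | hi'
      · obtain rfl : i = n + 1 := by omega
        simpa using hg
      · rw [hlt i hi', hvℓ i hi']
    · rcases Nat.lt_or_ge n j with hj' | hj'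
      · obtain rfl : j = n + 1 := by omega
        rcases Nat.lt_or_ge n i with hi' | hi'
        · obtain rfl : i = n + 1 := by omega
          simp [hℓ.one]
        · rw [hlt i hi', Function.update_self, ← mul_assoc]
          refine (hℓ.mul_le _ _).trans ?_
          have := hvd i n hi' le_rfl
          rw [hv] at this
          omega
      · rw [hlt i (hij.trans hj'), hlt j hj']
        exact hvd i j hij hj'

theorem exists_eq [Infinite G] (hℓ : IsWordLength ℓ) (n : ℕ) : ∃ g, ℓ g = n := by
  obtain ⟨g, hg⟩ := (hℓ.finite_ball n).infinite_compl.nonempty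
  have hg' : n < ℓ g := by simpa using hg
  obtain ⟨v, -, hv, -⟩ := hℓ.exists_geodesic _ g rfl
  exact ⟨v n, hv n hg'.le⟩

theorem le_add (hℓ : IsWordLength ℓ) (g h : G) : ℓ g ≤ ℓ h + ℓ (g⁻¹ * h) := by
  calc ℓ g = ℓ (h * (g⁻¹ * h)⁻¹) := by congr 1; group
    _ ≤ ℓ h + ℓ (g⁻¹ * h)⁻¹ := hℓ.mul_le _ _
    _ = _ := by rw [hℓ.inv]

theorem comm (hℓ : IsWordLength ℓ) (g h : G) : ℓ (g⁻¹ * h) = ℓ (h⁻¹ * g) := by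
  rw [← hℓ.inv (g⁻¹ * h)]
  simp

/-- Steps of unit length that stay outside the ball of radius `n`. -/
def StepOutside (ℓ : G → ℕ) (n : ℕ) (a b : G) : Prop :=
  n < ℓ a ∧ n < ℓ b ∧ ℓ (a⁻¹ * b) ≤ 1

/-- Along a geodesic of length `k` the word length drops by at most `k`, so starting beyond `n + k`
it never enters the ball of radius `n`. -/
theorem reflTransGen_stepOutside (hℓ : IsWordLength ℓ) (n k : ℕ) : ∀ a b, ℓ (a⁻¹ * b) = k →
    n + k < ℓ a → Relation.ReflTransGen (StepOutside ℓ n) a b := by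
  induction k with
  | zero =>
    intro a b hab ha
    -- `IsWordLength` does not exclude nontrivial elements of length zero, so distinct points at
    -- distance zero need one step.
    by_cases h : a = b
    · subst h; exact .refl
    · have hb := hℓ.le_add a b
      exact .single ⟨by omega, by omega, by omega⟩
  | succ k ih =>
    intro a b hab ha
    obtain ⟨h, s, hs, hh, hs1⟩ := hℓ.exists_pred k _ hab
    have hb : b = a * h * s := by rw [mul_assoc, ← hs]; group
    have h1 := hℓ.le_add a (a * h)
    have h2 := hℓ.le_add a b
    have e1 : a⁻¹ * (a * h) = h := by group
    rw [e1] at h1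
    refine (ih a (a * h) (by rw [e1, hh]) (by omega)).tail ⟨by omega, by omega, ?_⟩
    rw [hb]
    simpa [mul_assoc] using hs1

end IsWordLength

end WordLength

/-! ### Cocompact covering actions and transfer of one-endedness to the group -/

section QuotientCovering

variable {X B Γ : Type*} [TopologicalSpace X] [TopologicalSpace B] [Group Γ] [MulAction Γ X]
  {q : X → B}

/-- The covering group acts properly discontinuously. -/
theorem finite_setOf_smul_mem [T2Space B] (hq : IsQuotientCoveringMap q Γ) {F F' : Set X}
    (hF : IsCompact F) (hF' : IsCompact F') : {g : Γ | ∃ x ∈ F, g • x ∈ F'}.Finite := by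
  have hcont := hq.toContinuousConstSMul
  -- By compactness of the product it suffices to find, around each pair, a neighbourhood linked by
  -- finitely many `g`: exactly one if the pair lies in one orbit, none if the images in the
  -- Hausdorff base differ.
  have key : {g : Γ | ∃ w ∈ F ×ˢ F', g • w.1 = w.2}.Finite := by
    refine (hF.prod hF').induction_on (p := fun W => {g : Γ | ∃ w ∈ W, g • w.1 = w.2}.Finite)
      (by simp) (fun s t hst ht => ht.subset fun g ⟨w, hw, h⟩ => ⟨w, hst hw, h⟩)
      (fun s t hs ht => (hs.union ht).subset ?_) ?_
    · rintro g ⟨w, hw | hw, h⟩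
      exacts [Or.inl ⟨w, hw, h⟩, Or.inr ⟨w, hw, h⟩]
    · rintro ⟨x, y⟩ -
      by_cases hxy : q x = q y
      · obtain ⟨g₀, rfl : g₀ • x = y⟩ := hq.apply_eq_iff_mem_orbit.1 hxy.symm
        obtain ⟨U, hU, hdis⟩ := hq.disjoint x
        refine ⟨U ×ˢ ((g₀ • ·) '' U), mem_nhdsWithin_of_mem_nhds (prod_mem_nhds hU ?_),
          (finite_singleton g₀).subset ?_⟩
        · exact (Homeomorph.smul g₀).isOpenMap.image_mem_nhds hU
        · rintro g ⟨⟨u, v⟩, ⟨hu, u', hu', rfl⟩, h⟩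
          have h' : g • u = g₀ • u' := h
          have : g₀⁻¹ * g = 1 := hdis _ ⟨u', ⟨u, hu, by
            simp only [mul_smul, h', inv_smul_smul]⟩, hu'⟩
          exact (inv_mul_eq_one.1 this).symm
      · obtain ⟨U, V, hU, hV, hx, hy, hUV⟩ := t2_separation hxy
        refine ⟨(q ⁻¹' U) ×ˢ (q ⁻¹' V), mem_nhdsWithin_of_mem_nhds (prod_mem_nhds
          ((hU.preimage hq.continuous).mem_nhds hx) ((hV.preimage hq.continuous).mem_nhds hy)), ?_⟩
        convert finite_empty
        rw [eq_empty_iff_forall_notMem]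
        rintro g ⟨⟨u, v⟩, ⟨hu, hv⟩, h⟩
        have h' : g • u = v := h
        have : q v = q u := h' ▸ hq.map_smul g
        exact hUV.le_bot ⟨hu, this ▸ hv⟩
  exact key.subset fun g ⟨x, hx, hgx⟩ => ⟨(x, g • x), ⟨hx, hgx⟩, rfl⟩

/-- A compact set whose interior meets every orbit. -/
theorem exists_compact_interior_meets_orbits [CompactSpace B] [LocallyCompactSpace X]
    (hq : IsQuotientCoveringMap q Γ) :
    ∃ F : Set X, IsCompact F ∧ ∀ x, ∃ g : Γ, ∃ y ∈ interior F, x = g • y := by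
  choose s hs using hq.surjective
  choose C hC using fun b => exists_compact_mem_nhds (s b)
  obtain ⟨t, ht⟩ := isCompact_univ.elim_finite_subcover (fun b => q '' interior (C b))
    (fun b => hq.isOpenQuotientMap.isOpenMap _ isOpen_interior)
    fun b _ => mem_iUnion.2 ⟨b, s b, mem_interior_iff_mem_nhds.2 (hC b).2, hs b⟩
  refine ⟨⋃ b ∈ t, C b, t.isCompact_biUnion fun b _ => (hC b).1, fun x => ?_⟩
  obtain ⟨b, hb, y, hy, hyx⟩ := mem_iUnion₂.1 (ht (mem_univ (q x)))
  obtain ⟨g, hg⟩ := hq.apply_eq_iff_mem_orbit.1 hyx.symm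
  exact ⟨g, y, interior_mono (subset_biUnion_of_mem (u := fun b => C b) hb) hy, hg.symm⟩

theorem infinite_of_noncompactSpace [CompactSpace B] [LocallyCompactSpace X] [NoncompactSpace X]
    (hq : IsQuotientCoveringMap q Γ) : Infinite Γ := by
  have hcont := hq.toContinuousConstSMul
  obtain ⟨F, hF, hcov⟩ := exists_compact_interior_meets_orbits hq
  by_contra hfin
  rw [not_infinite_iff_finite] at hfin
  refine noncompact_univ X ?_
  convert isCompact_iUnion fun g : Γ => hF.image (continuous_const_smul g)
  refine (eq_univ_of_forall fun x => ?_).symm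
  obtain ⟨g, y, hy, rfl⟩ := hcov x
  exact mem_iUnion.2 ⟨g, y, interior_subset hy, rfl⟩

/-- If the covering space has one end, then the covering group is coarsely one-ended. -/
theorem exists_forall_reflTransGen_stepOutside [T2Space B] [CompactSpace B] [T2Space X]
    [LocallyCompactSpace X] [LocallyConnectedSpace X] [ConnectedSpace X]
    (hq : IsQuotientCoveringMap q Γ) (h1 : ENat.card (TopEnd X) = 1) {ℓ : Γ → ℕ}
    (hℓ : IsWordLength ℓ) (n : ℕ) :
    ∃ m, ∀ g h, m < ℓ g → m < ℓ h →
      Relation.ReflTransGen (IsWordLength.StepOutside ℓ n) g h := by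
  have hcont := hq.toContinuousConstSMul
  obtain ⟨F, hF, hcov⟩ := exists_compact_interior_meets_orbits hq
  obtain ⟨-, x₀, hx₀, -⟩ := hcov (Classical.arbitrary X)
  -- Translates of `F` that intersect have indices at word distance at most `c`.
  obtain ⟨c, hc⟩ := ((finite_setOf_smul_mem hq hF hF).image ℓ).bddAbove
  have hcF : ∀ a b : Γ, ∀ x ∈ F, ∀ y ∈ F, a • x = b • y → ℓ (a⁻¹ * b) ≤ c := by
    intro a b x hx y hy hxy
    refine hc ⟨_, ⟨y, hy, ?_⟩, rfl⟩
    rw [mul_smul, ← hxy, inv_smul_smul]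
    exact hx
  -- The margin `c` lets a geodesic between the indices of two translates meeting outside `K` stay
  -- outside the ball of radius `n`.
  set K : Set X := ⋃ g ∈ {g | ℓ g ≤ n + c}, (g • ·) '' F with hK
  have hKc : IsCompact K := (hℓ.finite_ball (n + c)).isCompact_biUnion fun g _ =>
    hF.image (continuous_const_smul g)
  obtain ⟨L, hL, hKL, hcomp⟩ := exists_compact_component_eq h1 hKc
  obtain ⟨m, hm⟩ := ((finite_setOf_smul_mem hq (isCompact_singleton (x := x₀)) hL).image ℓ).bddAbove
  have hout : ∀ g, m < ℓ g → g • x₀ ∉ L := fun g hg hgL =>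
    absurd (hm ⟨g, ⟨x₀, rfl, hgL⟩, rfl⟩) (by omega)
  have hKout : ∀ a : Γ, ∀ x ∈ F, a • x ∈ Kᶜ → n + c < ℓ a := by
    intro a x hx hax
    by_contra! hle
    exact hax (mem_iUnion₂.2 ⟨a, hle, x, hx, rfl⟩)
  refine ⟨m, fun g h hg hh => ?_⟩
  have hgK : g • x₀ ∈ Kᶜ := fun hg' => hout g hg (hKL hg')
  have hhK : h • x₀ ∈ Kᶜ := fun hh' => hout h hh (hKL hh')
  set U := connectedComponentIn Kᶜ (g • x₀)
  have hUK : U ⊆ Kᶜ := connectedComponentIn_subset _ _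
  have hhU : h • x₀ ∈ U := by
    simp only [U, hcomp _ (hout g hg) _ (hout h hh)]
    exact mem_connectedComponentIn hhK
  -- `R` and `R'` are the translates with index reachable, respectively not reachable, from `g`.
  -- They are open, cover the component `U`, and are disjoint on it by `step`, so connectedness of
  -- `U` makes `h` reachable.
  let R : Set X := ⋃ a ∈ {a | Relation.ReflTransGen (IsWordLength.StepOutside ℓ n) g a},
    (a • ·) '' interior F
  let R' : Set X := ⋃ a ∈ {a | ¬ Relation.ReflTransGen (IsWordLength.StepOutside ℓ n) g a},
    (a • ·) '' interior F
  have hopen : ∀ a : Γ, IsOpen ((a • ·) '' interior F) := fun a =>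
    (Homeomorph.smul a).isOpenMap _ isOpen_interior
  have hRo : IsOpen R := isOpen_biUnion fun a _ => hopen a
  have hRo' : IsOpen R' := isOpen_biUnion fun a _ => hopen a
  have step : ∀ a b : Γ, ∀ x ∈ F, ∀ y ∈ F, a • x = b • y → a • x ∈ Kᶜ →
      Relation.ReflTransGen (IsWordLength.StepOutside ℓ n) g a →
      Relation.ReflTransGen (IsWordLength.StepOutside ℓ n) g b := by
    intro a b x hx y hy hxy hax hga
    have h1 := hcF a b x hx y hy hxy
    have h2 := hKout a x hx hax
    exact hga.trans (hℓ.reflTransGen_stepOutside n _ a b rfl (by omega))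
  have hsub : U ⊆ R ∪ R' := by
    intro x _
    obtain ⟨a, y, hy, rfl⟩ := hcov x
    by_cases ha : Relation.ReflTransGen (IsWordLength.StepOutside ℓ n) g a
    · exact Or.inl (mem_iUnion₂.2 ⟨a, ha, y, hy, rfl⟩)
    · exact Or.inr (mem_iUnion₂.2 ⟨a, ha, y, hy, rfl⟩)
  have hgR : g • x₀ ∈ R := mem_iUnion₂.2 ⟨g, .refl, x₀, hx₀, rfl⟩
  by_contra hgh
  have hhR' : h • x₀ ∈ R' := mem_iUnion₂.2 ⟨h, hgh, x₀, hx₀, rfl⟩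
  obtain ⟨z, hzU, hzR, hzR'⟩ := isPreconnected_connectedComponentIn R R' hRo hRo' hsub
    ⟨_, mem_connectedComponentIn hgK, hgR⟩ ⟨_, hhU, hhR'⟩
  obtain ⟨a, ha, x, hx, rfl⟩ := mem_iUnion₂.1 hzR
  obtain ⟨b, hb, y, hy, hyx⟩ := mem_iUnion₂.1 hzR'
  exact hb (step a b x (interior_subset hx) y (interior_subset hy) hyx.symm (hUK hzU) ha)

end QuotientCovering

/-! ### Deck groups of regular coverings -/

section DeckGroup

variable {X B : Type*} [TopologicalSpace X] [TopologicalSpace B] {q : X → B}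

/-- The evaluation action of the deck transformations. -/
instance deckGroupMulAction : MulAction (deckGroup q) X where
  smul f x := f.1 x
  one_smul _ := rfl
  mul_smul _ _ _ := rfl

/-- Regularity identifies fibres with orbits; the action is free because two lifts of `q` to the
connected space `X` that agree at a point coincide. -/
theorem isQuotientCoveringMap_deckGroup [PreconnectedSpace X] (hq : IsRegularCovering q) :
    IsQuotientCoveringMap q (deckGroup q) := by
  rw [isQuotientCoveringMap_iff_isCoveringMap_and]
  refine ⟨hq.1, hq.2.1, ⟨fun f => f.1.continuous⟩,
    ⟨fun f g x h => Subtype.ext (Homeomorph.ext ?_)⟩, fun {x y} => ⟨fun h => ?_, ?_⟩⟩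
  · exact congrFun (hq.1.eq_of_comp_eq f.1.continuous g.1.continuous
      (funext fun y => (f.2 y).trans (g.2 y).symm) x h)
  · obtain ⟨f, hf, hfy⟩ := hq.2.2 y x h.symm
    exact ⟨⟨f, hf⟩, hfy⟩
  · rintro ⟨f, rfl⟩
    exact f.2 y

theorem t2Space_of_isCoveringMap [T2Space B] (hq : IsCoveringMap q) : T2Space X where
  t2 x y hxy := by
    by_cases h : q x = q y
    · exact hq.isSeparatedMap x y h hxy
    · obtain ⟨U, V, hU, hV, hx, hy, hUV⟩ := t2_separation h
      exact ⟨q ⁻¹' U, q ⁻¹' V, hU.preimage hq.continuous, hV.preimage hq.continuous, hx, hy,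
        hUV.preimage q⟩

/-- A local homeomorphism makes its source a charted space over its target. -/
noncomputable abbrev chartedSpaceOfIsLocalHomeomorph (hq : IsLocalHomeomorph q) : ChartedSpace B X where
  atlas := range fun x => (hq x).choose
  chartAt x := (hq x).choose
  mem_chart_source x := (hq x).choose_spec.1
  chart_mem_atlas x := ⟨x, rfl⟩

theorem HasNumEnds.infinite_and_oneEnded {G : Type*} [Group G] (h : HasNumEnds G 1) {ℓ : G → ℕ}
    (hℓ : IsWordLength ℓ) : Infinite G ∧ ∀ n, ∃ m, ∀ g h, m < ℓ g → m < ℓ h →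
      Relation.ReflTransGen (IsWordLength.StepOutside ℓ n) g h := by
  obtain ⟨m, K, X, _, q, hK, hconn, hreg, ⟨e⟩, h1⟩ := h
  have := simplicialComplex_compactSpace K hK
  have := simplicialComplex_locallyConnectedSpace K hK
  have hT2 := t2Space_of_isCoveringMap hreg.1
  let _ := chartedSpaceOfIsLocalHomeomorph hreg.1.isLocalHomeomorph
  have : LocallyCompactSpace X := ChartedSpace.locallyCompactSpace K.space X
  have : LocallyConnectedSpace X := ChartedSpace.locallyConnectedSpace K.space X
  have hq := isQuotientCoveringMap_deckGroup hreg
  obtain ⟨hu⟩ := ENat.card_eq_one_iff_unique.1 h1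
  have := noncompactSpace_of_nonempty_topEnd ⟨hu.default⟩
  have hinf := infinite_of_noncompactSpace hq
  have hℓ' : IsWordLength (ℓ ∘ e.symm) := by
    refine ⟨by simp [hℓ.one], fun g h => by simpa using hℓ.mul_le _ _, fun g => by simp [hℓ.inv],
      fun n => ?_, fun n g hg => ?_⟩
    · exact ((hℓ.finite_ball n).image e).subset fun g hg => ⟨e.symm g, hg, by simp⟩
    · obtain ⟨h, s, hs, hh, hs1⟩ := hℓ.exists_pred n _ hg
      exact ⟨e h, e s, by rw [← map_mul, ← hs]; simp, by simpa using hh, by simpa using hs1⟩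
  refine ⟨Infinite.of_injective e.symm e.symm.injective, fun n => ?_⟩
  obtain ⟨k, hk⟩ := exists_forall_reflTransGen_stepOutside hq h1 hℓ' n
  refine ⟨k, fun g h hg hh => ?_⟩
  have := hk (e g) (e h) (by simpa using hg) (by simpa using hh)
  have := this.lift e.symm (p := IsWordLength.StepOutside ℓ n) fun a b hab =>
    ⟨hab.1, hab.2.1, by simpa using hab.2.2⟩
  simpa [Function.onFun] using this

end DeckGroup

/-! ### Smooth arcs: gluing, loop erasure and closing up -/

section SmoothArcs

/-- With `f = expNegInvGlue`, cross-multiplying `f u / (f u + f (1 - u))` leaves `f s * f (1 - t) <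
f t * f (1 - s)`, which follows from strict growth of `f` on `[0, ∞)`. It keeps arcs injective after
the reparametrization that flattens their ends. -/
theorem strictMonoOn_smoothTransition : StrictMonoOn Real.smoothTransition (Icc 0 1) := by
  have hglue : StrictMonoOn expNegInvGlue (Ici 0) := by
    intro s hs t ht hst
    rcases (mem_Ici.1 hs).eq_or_lt with rfl | hs
    · simpa using expNegInvGlue.pos_of_pos hst
    · have ht : 0 < t := hs.trans hst
      simp only [expNegInvGlue, not_le.2 hs, not_le.2 ht, if_false]
      gcongr
  intro s hs t ht hst
  have h1 : expNegInvGlue s < expNegInvGlue t := hglue hs.1 ht.1 hst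
  have h2 : expNegInvGlue (1 - t) ≤ expNegInvGlue (1 - s) :=
    expNegInvGlue.monotone (by linarith)
  have h3 : 0 < expNegInvGlue (1 - s) := expNegInvGlue.pos_of_pos (by linarith [ht.2])
  have h4 := expNegInvGlue.nonneg s
  have h5 := expNegInvGlue.nonneg (1 - t)
  simp only [Real.smoothTransition]
  rw [div_lt_div_iff₀ (by positivity) (by linarith)]
  nlinarith

variable {E : Type*} [NormedAddCommGroup E] [NormedSpace ℝ E]
  {M : Type*} [TopologicalSpace M] [ChartedSpace E M]

/-- Two smooth curves that are constant after, respectively before, the time `c` and meet there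
can be glued to a smooth curve. -/
theorem contMDiff_glue [IsManifold 𝓘(ℝ, E) ∞ M] {A B : ℝ → M} {c : ℝ} {x : M}
    (hA : ContMDiff 𝓘(ℝ, ℝ) 𝓘(ℝ, E) ∞ A) (hB : ContMDiff 𝓘(ℝ, ℝ) 𝓘(ℝ, E) ∞ B)
    (hAc : ∀ t, c ≤ t → A t = x) (hBc : ∀ t ≤ c, B t = x) :
    ContMDiff 𝓘(ℝ, ℝ) 𝓘(ℝ, E) ∞ fun t => if t ≤ c then A t else B t := by
  intro t
  rcases lt_trichotomy t c with htc | rfl | htc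
  · refine hA.contMDiffAt.congr_of_eventuallyEq ?_
    filter_upwards [Iio_mem_nhds htc] with s hs
    exact if_pos (le_of_lt hs)
  · have hxA : A t = x := hAc t le_rfl
    have hxB : B t = x := hBc t le_rfl
    have hφA : ContMDiffAt 𝓘(ℝ, ℝ) 𝓘(ℝ, E) ∞ (fun s => extChartAt 𝓘(ℝ, E) x (A s)) t :=
      ContMDiffAt.comp t (hxA ▸ contMDiffAt_extChartAt) hA.contMDiffAt
    have hφB : ContMDiffAt 𝓘(ℝ, ℝ) 𝓘(ℝ, E) ∞ (fun s => extChartAt 𝓘(ℝ, E) x (B s)) t :=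
      ContMDiffAt.comp t (hxB ▸ contMDiffAt_extChartAt) hB.contMDiffAt
    -- On either side of the junction one of the two summands equals the subtracted constant, so
    -- this single smooth expression is the glued curve in the chart.
    have hsum : ContMDiffAt 𝓘(ℝ, ℝ) 𝓘(ℝ, E) ∞ (fun s => extChartAt 𝓘(ℝ, E) x (A s) +
        extChartAt 𝓘(ℝ, E) x (B s) - extChartAt 𝓘(ℝ, E) x x) t :=
      (hφA.add hφB).sub contMDiffAt_const
    have hsymm : ContMDiffAt 𝓘(ℝ, E) 𝓘(ℝ, E) ∞ (extChartAt 𝓘(ℝ, E) x).symm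
        (extChartAt 𝓘(ℝ, E) x x) := by
      refine (contMDiffOn_extChartAt_symm x).contMDiffAt ?_
      exact extChartAt_target_mem_nhds x
    have hcomp := ContMDiffAt.comp (f := fun s => extChartAt 𝓘(ℝ, E) x (A s) +
        extChartAt 𝓘(ℝ, E) x (B s) - extChartAt 𝓘(ℝ, E) x x) (g := (extChartAt 𝓘(ℝ, E) x).symm) t
        (by simpa [hxA, hxB] using hsymm) hsum
    refine hcomp.congr_of_eventuallyEq ?_
    have hsA : ∀ᶠ s in 𝓝 t, A s ∈ (extChartAt 𝓘(ℝ, E) x).source :=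
      hA.continuous.continuousAt.preimage_mem_nhds (hxA ▸ extChartAt_source_mem_nhds x)
    have hsB : ∀ᶠ s in 𝓝 t, B s ∈ (extChartAt 𝓘(ℝ, E) x).source :=
      hB.continuous.continuousAt.preimage_mem_nhds (hxB ▸ extChartAt_source_mem_nhds x)
    filter_upwards [hsA, hsB] with s hsA hsB
    by_cases hst : s ≤ t
    · simp only [hst, if_true, Function.comp_apply, hBc s hst, add_sub_cancel_right]
      exact ((extChartAt 𝓘(ℝ, E) x).left_inv hsA).symm
    · simp only [hst, if_false, Function.comp_apply, hAc s (le_of_not_ge hst), add_sub_cancel_left]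
      exact ((extChartAt 𝓘(ℝ, E) x).left_inv hsB).symm
  · refine hB.contMDiffAt.congr_of_eventuallyEq ?_
    filter_upwards [Ioi_mem_nhds htc] with s hs
    exact if_neg (not_le.2 hs)

/-- A smooth arc from `x` to `y`, traversed during `[0, 1]` and stationary at other times. -/
structure IsFlatArc (A : ℝ → M) (x y : M) : Prop where
  smooth : ContMDiff 𝓘(ℝ, ℝ) 𝓘(ℝ, E) ∞ A
  left : ∀ t ≤ 0, A t = x
  right : ∀ t, 1 ≤ t → A t = y
  inj : InjOn A (Icc 0 1)

namespace IsFlatArc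

variable {A B : ℝ → M} {x y z : M}

theorem zero (hA : IsFlatArc (E := E) A x y) : A 0 = x := hA.left 0 le_rfl

theorem one (hA : IsFlatArc (E := E) A x y) : A 1 = y := hA.right 1 le_rfl

theorem isCompact_image (hA : IsFlatArc (E := E) A x y) : IsCompact (A '' Icc 0 1) :=
  isCompact_Icc.image hA.smooth.continuous

/-- The smooth reparametrization of an interval with endpoints `s` and `t`. -/
noncomputable def ramp (s t : ℝ) (u : ℝ) : ℝ := s + (t - s) * Real.smoothTransition u

theorem contDiff_ramp (s t : ℝ) : ContDiff ℝ ∞ (ramp s t) :=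
  contDiff_const.add (contDiff_const.mul Real.smoothTransition.contDiff)

theorem ramp_of_nonpos (s t : ℝ) {u : ℝ} (hu : u ≤ 0) : ramp s t u = s := by
  simp [ramp, Real.smoothTransition.zero_of_nonpos hu]

theorem ramp_of_one_le (s t : ℝ) {u : ℝ} (hu : 1 ≤ u) : ramp s t u = t := by
  simp [ramp, Real.smoothTransition.one_of_one_le hu]

theorem ramp_mem_uIcc (s t u : ℝ) : ramp s t u ∈ uIcc s t := by
  have h0 := Real.smoothTransition.nonneg u
  have h1 := Real.smoothTransition.le_one u
  rw [← segment_eq_uIcc]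
  exact ⟨1 - Real.smoothTransition u, Real.smoothTransition u, by linarith, h0, by ring,
    by simp only [ramp, smul_eq_mul]; ring⟩

theorem injOn_ramp {s t : ℝ} (hst : s ≠ t) : InjOn (ramp s t) (Icc 0 1) := by
  intro u hu v hv huv
  refine strictMonoOn_smoothTransition.injOn hu hv ?_
  have : (t - s) * (Real.smoothTransition u - Real.smoothTransition v) = 0 := by
    simp only [ramp] at huv
    linarith
  rcases mul_eq_zero.1 this with h | h
  · exact absurd (by linarith) hst
  · linarith

theorem comp_ramp {s t : ℝ} (hA : ContMDiff 𝓘(ℝ, ℝ) 𝓘(ℝ, E) ∞ A) (hst : s ≠ t)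
    (hinj : InjOn A (uIcc s t)) : IsFlatArc (E := E) (A ∘ ramp s t) (A s) (A t) where
  smooth := hA.comp (contDiff_ramp s t).contMDiff
  left u hu := by simp [ramp_of_nonpos s t hu]
  right u hu := by simp [ramp_of_one_le s t hu]
  inj := hinj.comp (injOn_ramp hst) fun u _ => ramp_mem_uIcc s t u

theorem restrict (hA : IsFlatArc (E := E) A x y) {s t : ℝ} (hs : s ∈ Icc (0 : ℝ) 1)
    (ht : t ∈ Icc (0 : ℝ) 1) (hst : s ≠ t) : IsFlatArc (E := E) (A ∘ ramp s t) (A s) (A t) :=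
  comp_ramp hA.smooth hst (hA.inj.mono (uIcc_subset_Icc hs ht))

theorem image_comp_ramp_subset {M : Type*} (A : ℝ → M) (s t : ℝ) (T : Set ℝ) :
    (A ∘ ramp s t) '' T ⊆ A '' uIcc s t := by
  rintro _ ⟨u, -, rfl⟩
  exact ⟨_, ramp_mem_uIcc s t u, rfl⟩

/-- Concatenation of two curves, each of which is traversed in half of the time. -/
noncomputable def concat {M : Type*} (A B : ℝ → M) (t : ℝ) : M :=
  if t ≤ 1 / 2 then A (2 * t) else B (2 * t - 1)

theorem contMDiff_concat [IsManifold 𝓘(ℝ, E) ∞ M] (hA : IsFlatArc (E := E) A x y)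
    (hB : IsFlatArc (E := E) B y z) : ContMDiff 𝓘(ℝ, ℝ) 𝓘(ℝ, E) ∞ (concat A B) := by
  refine contMDiff_glue (A := fun t => A (2 * t)) (B := fun t => B (2 * t - 1)) (x := y)
    (hA.smooth.comp ?_) (hB.smooth.comp ?_) (fun t ht => hA.right _ (by linarith))
    (fun t ht => hB.left _ (by linarith))
  · exact ContDiff.contMDiff (by fun_prop)
  · exact ContDiff.contMDiff (by fun_prop)

theorem concat_left (hA : IsFlatArc (E := E) A x y) {t : ℝ} (ht : t ≤ 0) : concat A B t = x := by
  rw [concat, if_pos (by linarith), hA.left _ (by linarith)]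

theorem concat_right (hB : IsFlatArc (E := E) B y z) {t : ℝ} (ht : 1 ≤ t) : concat A B t = z := by
  rw [concat, if_neg (by linarith), hB.right _ (by linarith)]

theorem image_concat_subset {M : Type*} {A B : ℝ → M} : concat A B '' Icc 0 1 ⊆ A '' Icc 0 1 ∪ B '' Icc 0 1 := by
  rintro _ ⟨t, ht, rfl⟩
  by_cases h : t ≤ 1 / 2
  · exact Or.inl ⟨2 * t, ⟨by linarith [ht.1], by linarith⟩, by rw [concat, if_pos h]⟩
  · exact Or.inr ⟨2 * t - 1, ⟨by linarith [not_le.1 h], by linarith [ht.2]⟩,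
      by rw [concat, if_neg h]⟩

theorem concat_isFlatArc [IsManifold 𝓘(ℝ, E) ∞ M] (hA : IsFlatArc (E := E) A x y)
    (hB : IsFlatArc (E := E) B y z)
    (hAB : ∀ s ∈ Icc (0 : ℝ) 1, ∀ t ∈ Icc (0 : ℝ) 1, A s = B t → t = 0) :
    IsFlatArc (E := E) (concat A B) x z where
  smooth := contMDiff_concat hA hB
  left _ ht := concat_left hA ht
  right _ ht := concat_right hB ht
  inj := by
    intro s hs t ht hst
    simp only [concat] at hst
    split_ifs at hst with h1 h2 h2
    · have := hA.inj ⟨by linarith [hs.1], by linarith⟩ ⟨by linarith [ht.1], by linarith⟩ hst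
      linarith
    · have := hAB _ ⟨by linarith [hs.1], by linarith⟩ _
        ⟨by linarith [not_le.1 h2], by linarith [ht.2]⟩ hst
      linarith [not_le.1 h2]
    · have := hAB _ ⟨by linarith [ht.1], by linarith⟩ _
        ⟨by linarith [not_le.1 h1], by linarith [hs.2]⟩ hst.symm
      linarith [not_le.1 h1]
    · have := hB.inj ⟨by linarith [not_le.1 h1], by linarith [hs.2]⟩
        ⟨by linarith [not_le.1 h2], by linarith [ht.2]⟩ hst
      linarith

/-- Concatenation of two arcs, with the loops erased. -/
theorem exists_trans [IsManifold 𝓘(ℝ, E) ∞ M] [T2Space M] (hA : IsFlatArc (E := E) A x y)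
    (hB : IsFlatArc (E := E) B y z) (hxz : x ≠ z) :
    ∃ C : ℝ → M, IsFlatArc (E := E) C x z ∧ C '' Icc 0 1 ⊆ A '' Icc 0 1 ∪ B '' Icc 0 1 := by
  have hcl : IsClosed (Icc (0 : ℝ) 1 ∩ A ⁻¹' (B '' Icc 0 1)) :=
    isClosed_Icc.inter (hB.isCompact_image.isClosed.preimage hA.smooth.continuous)
  have hcpt : IsCompact (Icc (0 : ℝ) 1 ∩ A ⁻¹' (B '' Icc 0 1)) :=
    isCompact_Icc.of_isClosed_subset hcl inter_subset_left
  -- Follow `A` up to its first point on `B`, then continue along `B`. Either remaining piece may be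
  -- degenerate, which gives the cases below.
  obtain ⟨s, ⟨hs, t, ht, hst⟩, hmin⟩ := hcpt.exists_isLeast
    ⟨1, ⟨by norm_num, 0, by norm_num, by rw [hA.one, hB.zero]⟩⟩
  have hAsub : A '' uIcc 0 s ⊆ A '' Icc 0 1 :=
    image_mono (uIcc_subset_Icc (by norm_num) hs)
  have hBsub : B '' uIcc t 1 ⊆ B '' Icc 0 1 :=
    image_mono (uIcc_subset_Icc ht (by norm_num))
  rcases eq_or_ne s 0 with rfl | hs0
  · rcases eq_or_ne t 1 with rfl | ht1
    · exact absurd (by rw [← hA.zero, ← hB.one, hst]) hxz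
    · have h := hB.restrict ht (by norm_num) ht1
      rw [hst, hA.zero, hB.one] at h
      exact ⟨_, h, ((image_comp_ramp_subset _ _ _ _).trans hBsub).trans subset_union_right⟩
  · have h1 := hA.restrict (by norm_num) hs hs0.symm
    rw [hA.zero] at h1
    rcases eq_or_ne t 1 with rfl | ht1
    · rw [← hst, hB.one] at h1
      exact ⟨_, h1, ((image_comp_ramp_subset _ _ _ _).trans hAsub).trans subset_union_left⟩
    · have h2 := hB.restrict ht (by norm_num) ht1
      rw [hst, hB.one] at h2
      refine ⟨_, h1.concat_isFlatArc h2 fun u hu v hv huv => ?_, image_concat_subset.trans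
        (union_subset_union ((image_comp_ramp_subset _ _ _ _).trans hAsub)
          ((image_comp_ramp_subset _ _ _ _).trans hBsub))⟩
      have hu' := ramp_mem_uIcc 0 s u
      rw [uIcc_of_le hs.1] at hu'
      have hv' := uIcc_subset_Icc ht (by norm_num) (ramp_mem_uIcc t 1 v)
      have hle := hmin ⟨⟨hu'.1, hu'.2.trans hs.2⟩, ⟨_, hv', huv.symm⟩⟩
      have hus : ramp 0 s u = s := le_antisymm hu'.2 hle
      have hvt : ramp t 1 v = t := by
        refine hB.inj hv' ht ?_
        rw [hst, ← hus]
        exact huv.symm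
      refine injOn_ramp ht1 hv (by norm_num) ?_
      rw [hvt, ramp_of_nonpos t 1 le_rfl]

/-- Close points are connected by short arcs. -/
theorem exists_nhds [IsManifold 𝓘(ℝ, E) ∞ M] {W : Set M} (hW : W ∈ 𝓝 z) :
    ∃ V ∈ 𝓝 z, ∀ x ∈ V, ∀ y ∈ V, x ≠ y →
      ∃ A : ℝ → M, IsFlatArc (E := E) A x y ∧ A '' Icc 0 1 ⊆ W := by
  set φ := extChartAt 𝓘(ℝ, E) z
  have hpre : φ.target ∩ φ.symm ⁻¹' W ∈ 𝓝 (φ z) := by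
    refine inter_mem (extChartAt_target_mem_nhds z) ?_
    refine (continuousAt_extChartAt_symm z).preimage_mem_nhds ?_
    simpa [φ] using hW
  obtain ⟨r, hr, hball⟩ := Metric.mem_nhds_iff.1 hpre
  refine ⟨φ.source ∩ φ ⁻¹' Metric.ball (φ z) r, ?_, ?_⟩
  · exact inter_mem (extChartAt_source_mem_nhds z)
      ((continuousAt_extChartAt z).preimage_mem_nhds (Metric.ball_mem_nhds _ hr))
  · rintro x ⟨hx, hxr⟩ y ⟨hy, hyr⟩ hxy
    have hne : φ x ≠ φ y := fun h => hxy (φ.injOn hx hy h)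
    have hmem : ∀ u, φ x + ramp 0 1 u • (φ y - φ x) ∈ Metric.ball (φ z) r := by
      intro u
      have hu := ramp_mem_uIcc 0 1 u
      rw [uIcc_of_le zero_le_one] at hu
      have := (convex_ball (φ z) r) hxr hyr (sub_nonneg.2 hu.2) hu.1 (by ring)
      convert this using 1
      module
    refine ⟨fun u => φ.symm (φ x + ramp 0 1 u • (φ y - φ x)), ⟨?_, ?_, ?_, ?_⟩, ?_⟩
    · intro u
      have h1 : ContMDiffAt 𝓘(ℝ, E) 𝓘(ℝ, E) ∞ φ.symm (φ x + ramp 0 1 u • (φ y - φ x)) :=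
        (contMDiffOn_extChartAt_symm z).contMDiffAt
          (mem_of_superset (Metric.isOpen_ball.mem_nhds (hmem u)) fun w hw => (hball hw).1)
      have h2 : ContMDiff 𝓘(ℝ, ℝ) 𝓘(ℝ, E) ∞ fun u => φ x + ramp 0 1 u • (φ y - φ x) :=
        (contDiff_const.add ((contDiff_ramp 0 1).smul contDiff_const)).contMDiff
      exact ContMDiffAt.comp (f := fun u => φ x + ramp 0 1 u • (φ y - φ x)) u h1 h2.contMDiffAt
    · intro u hu
      simp [ramp_of_nonpos 0 1 hu, φ.left_inv hx]
    · intro u hu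
      simp [ramp_of_one_le 0 1 hu, φ.left_inv hy]
    · intro u hu v hv huv
      have h1 := φ.symm.injOn (hball (hmem u)).1 (hball (hmem v)).1 huv
      have h2 : ramp 0 1 u = ramp 0 1 v :=
        smul_left_injective ℝ (sub_ne_zero.2 hne.symm) (add_left_cancel h1)
      exact injOn_ramp zero_ne_one hu hv h2
    · rintro _ ⟨u, -, rfl⟩
      exact (hball (hmem u)).2

theorem exists_symm (hA : IsFlatArc (E := E) A x y) :
    ∃ C : ℝ → M, IsFlatArc (E := E) C y x ∧ C '' Icc 0 1 ⊆ A '' Icc 0 1 := by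
  have h := hA.restrict (s := 1) (t := 0) (by norm_num) (by norm_num) one_ne_zero
  rw [hA.zero, hA.one] at h
  refine ⟨_, h, ?_⟩
  simpa using image_comp_ramp_subset A 1 0 (Icc 0 1)

/-- Two points of a connected open set are connected by a smooth arc inside that set. -/
theorem exists_of_isPreconnected [IsManifold 𝓘(ℝ, E) ∞ M] [T2Space M] {U : Set M}
    (hU : IsOpen U) (hconn : IsPreconnected U) (hx : x ∈ U) (hy : y ∈ U) (hxy : x ≠ y) :
    ∃ A : ℝ → M, IsFlatArc (E := E) A x y ∧ A '' Icc 0 1 ⊆ U := by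
  -- Equality is allowed separately because flat arcs are injective, so no constant arc joins a
  -- point to itself.
  let P : M → M → Prop := fun a b =>
    a = b ∨ ∃ A : ℝ → M, IsFlatArc (E := E) A a b ∧ A '' Icc 0 1 ⊆ U
  have hsymm : ∀ a b, P a b → P b a := by
    rintro a b (rfl | ⟨A, hA, hAU⟩)
    · exact Or.inl rfl
    · obtain ⟨C, hC, hCA⟩ := hA.exists_symm
      exact Or.inr ⟨C, hC, hCA.trans hAU⟩
  have htrans : ∀ a b c, P a b → P b c → P a c := by
    rintro a b c (rfl | ⟨A, hA, hAU⟩) (rfl | ⟨B, hB, hBU⟩)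
    · exact Or.inl rfl
    · exact Or.inr ⟨B, hB, hBU⟩
    · exact Or.inr ⟨A, hA, hAU⟩
    · rcases eq_or_ne a c with h | h
      · exact Or.inl h
      · obtain ⟨C, hC, hCAB⟩ := hA.exists_trans hB h
        exact Or.inr ⟨C, hC, hCAB.trans (union_subset hAU hBU)⟩
  have hP : P x y := by
    refine hconn.induction₂ P (fun a ha => ?_) (fun a b c _ _ _ => htrans a b c)
      (fun a b _ _ => hsymm a b) hx hy
    obtain ⟨V, hV, hVP⟩ := exists_nhds (E := E) (hU.mem_nhds ha)
    refine mem_nhdsWithin_of_mem_nhds (mem_of_superset hV fun b hb => ?_)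
    rcases eq_or_ne a b with h | h
    · exact Or.inl h
    · exact Or.inr (hVP a (mem_of_mem_nhds hV) b hb h)
  exact hP.resolve_left hxy

/-- Two arcs with the same endpoints and otherwise disjoint form a simple closed curve. -/
theorem exists_isSmoothSimpleClosedCurve [IsManifold 𝓘(ℝ, E) ∞ M]
    (hA : IsFlatArc (E := E) A x y) (hB : IsFlatArc (E := E) B y x)
    (hAB : ∀ s ∈ Icc (0 : ℝ) 1, ∀ t ∈ Icc (0 : ℝ) 1, A s = B t → t = 0 ∨ t = 1) :
    ∃ γ : ℝ → M, IsSmoothSimpleClosedCurve 𝓘(ℝ, E) γ ∧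
      (∀ t ∈ Icc (0 : ℝ) (1 / 2), γ t = A (2 * t)) ∧
      (∀ t ∈ Icc (1 / 2 : ℝ) 1, γ t = B (2 * t - 1)) ∧
      range γ ⊆ A '' Icc 0 1 ∪ B '' Icc 0 1 := by
  set C := concat A B with hC
  have hCs : ContMDiff 𝓘(ℝ, ℝ) 𝓘(ℝ, E) ∞ C := contMDiff_concat hA hB
  have hC0 : ∀ t ≤ 0, C t = x := fun t ht => concat_left hA ht
  have hC1 : ∀ t, 1 ≤ t → C t = x := fun t ht => concat_right hB ht
  have hγ : ∀ t ∈ Icc (0 : ℝ) 1, C (Int.fract t) = C t := by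
    intro t ht
    rcases ht.2.lt_or_eq with h | rfl
    · rw [Int.fract_eq_self.2 ⟨ht.1, h⟩]
    · rw [Int.fract_one, hC0 0 le_rfl, hC1 1 le_rfl]
  refine ⟨fun t => C (Int.fract t), ⟨?_, fun t => by simp, ?_⟩, ?_, ?_, ?_⟩
  · intro t
    -- Near `t` the periodic extension is two consecutive copies of `C` glued at the integer `⌊t⌋`,
    -- where both are stationary at `x`.
    have hglue : ContMDiff 𝓘(ℝ, ℝ) 𝓘(ℝ, E) ∞ fun s : ℝ =>
        if s ≤ (⌊t⌋ : ℝ) then C (s - ⌊t⌋ + 1) else C (s - ⌊t⌋) := by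
      refine contMDiff_glue (A := fun s => C (s - ⌊t⌋ + 1)) (B := fun s => C (s - ⌊t⌋)) (x := x)
        (hCs.comp ?_) (hCs.comp ?_) (fun s hs => hC1 _ (by linarith))
        (fun s hs => hC0 _ (by linarith))
      · exact ContDiff.contMDiff (by fun_prop)
      · exact ContDiff.contMDiff (by fun_prop)
    refine hglue.contMDiffAt.congr_of_eventuallyEq ?_
    have h1 : (⌊t⌋ : ℝ) - 1 < t := by linarith [Int.floor_le t]
    filter_upwards [Ioo_mem_nhds h1 (Int.lt_floor_add_one t)] with s hs
    rcases lt_trichotomy s (⌊t⌋ : ℝ) with h | h | h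
    · have hf : ⌊s⌋ = ⌊t⌋ - 1 := Int.floor_eq_iff.2 ⟨by push_cast; linarith [hs.1],
        by push_cast; linarith⟩
      rw [if_pos h.le, Int.fract, hf]
      push_cast
      ring_nf
    · rw [if_pos h.le, h]
      simp [hC0 0 le_rfl, hC1 1 le_rfl]
    · have hf : ⌊s⌋ = ⌊t⌋ := Int.floor_eq_iff.2 ⟨h.le, hs.2⟩
      rw [if_neg (not_le.2 h), Int.fract, hf]
  · intro s hs t ht hst
    simp only [Int.fract_eq_self.2 hs, Int.fract_eq_self.2 ht, C, concat] at hst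
    have key : ∀ s t : ℝ, s ∈ Ico (0 : ℝ) 1 → t ∈ Ico (0 : ℝ) 1 → s ≤ 1 / 2 → ¬ t ≤ 1 / 2 →
        A (2 * s) ≠ B (2 * t - 1) := by
      intro s t hs ht h1 h2 h
      rcases hAB _ ⟨by linarith [hs.1], by linarith⟩ _
        ⟨by linarith [not_le.1 h2], by linarith [ht.2]⟩ h with h | h
      · linarith [not_le.1 h2]
      · linarith [ht.2]
    split_ifs at hst with h1 h2 h2
    · have := hA.inj ⟨by linarith [hs.1], by linarith⟩ ⟨by linarith [ht.1], by linarith⟩ hst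
      linarith
    · exact absurd hst (key s t hs ht h1 h2)
    · exact absurd hst.symm (key t s ht hs h2 h1)
    · have := hB.inj ⟨by linarith [not_le.1 h1], by linarith [hs.2]⟩
        ⟨by linarith [not_le.1 h2], by linarith [ht.2]⟩ hst
      linarith
  · intro t ht
    simp only [hγ t ⟨ht.1, by linarith [ht.2]⟩, C, concat, if_pos ht.2]
  · intro t ht
    simp only [hγ t ⟨by linarith [ht.1], ht.2⟩, C, concat]
    split_ifs with h
    · have : t = 1 / 2 := le_antisymm h ht.1
      subst this
      norm_num [hA.one, hB.zero]
    · rfl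
  · rintro _ ⟨t, rfl⟩
    exact image_concat_subset ⟨Int.fract t, ⟨Int.fract_nonneg t, (Int.fract_lt_one t).le⟩, rfl⟩

end IsFlatArc

end SmoothArcs

/-! ### Discs, null-homotopies and degree -/

section Discs

open unitInterval

/-- Polar coordinates on the closed unit disc. -/
noncomputable def discPolar (w : I × I) : Metric.closedBall (0 : ℂ) 1 :=
  ⟨(σ w.1 : ℝ) * Complex.exp (2 * Real.pi * (w.2 : ℝ) * Complex.I), by
    have h : ‖Complex.exp (2 * Real.pi * (w.2 : ℝ) * Complex.I)‖ = 1 := by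
      have := Complex.norm_exp_ofReal_mul_I (2 * Real.pi * (w.2 : ℝ))
      push_cast at this
      exact this
    rw [mem_closedBall_zero_iff, norm_mul, h, mul_one, Complex.norm_real, Real.norm_eq_abs,
      abs_of_nonneg (σ w.1).2.1]
    exact (σ w.1).2.2⟩

theorem isQuotientMap_discPolar : IsQuotientMap discPolar := by
  have hcont : Continuous discPolar := by
    unfold discPolar
    fun_prop
  refine hcont.isClosedMap.isQuotientMap hcont ?_
  rintro ⟨z, hz⟩
  rw [mem_closedBall_zero_iff] at hz
  set t : ℝ := Int.fract (Complex.arg z / (2 * Real.pi)) with ht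
  refine ⟨(⟨1 - ‖z‖, by linarith, by linarith [norm_nonneg z]⟩,
    ⟨t, Int.fract_nonneg _, (Int.fract_lt_one _).le⟩), Subtype.ext ?_⟩
  have hpi : (2 * Real.pi : ℝ) ≠ 0 := by positivity
  have hexp : Complex.exp (2 * Real.pi * (t : ℂ) * Complex.I) = Complex.exp (z.arg * Complex.I) := by
    rw [Complex.exp_eq_exp_iff_exists_int]
    refine ⟨-⌊Complex.arg z / (2 * Real.pi)⌋, ?_⟩
    have : (t : ℂ) = Complex.arg z / (2 * Real.pi) - ⌊Complex.arg z / (2 * Real.pi)⌋ := by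
      rw [ht, Int.fract]
      push_cast
      rfl
    rw [this]
    have hpi' : (Real.pi : ℂ) ≠ 0 := Complex.ofReal_ne_zero.2 Real.pi_ne_zero
    push_cast
    field_simp
    ring
  simp only [discPolar, unitInterval.coe_symm_eq, hexp, sub_sub_cancel]
  exact Complex.norm_mul_exp_arg_mul_I z

theorem exp_eq_exp_iff_of_mem_unitInterval {s t : I}
    (h : Complex.exp (2 * Real.pi * (s : ℝ) * Complex.I) =
      Complex.exp (2 * Real.pi * (t : ℝ) * Complex.I)) :
    s = t ∨ (s = 0 ∧ t = 1) ∨ (s = 1 ∧ t = 0) := by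
  obtain ⟨n, hn⟩ := Complex.exp_eq_exp_iff_exists_int.1 h
  have hpi' : (Real.pi : ℂ) ≠ 0 := Complex.ofReal_ne_zero.2 Real.pi_ne_zero
  have h1 : ((s : ℝ) : ℂ) = (t : ℝ) + n := by
    have h2 : (2 * Real.pi * Complex.I) * (((s : ℝ) : ℂ) - ((t : ℝ) + n)) = 0 := by
      linear_combination hn
    rcases mul_eq_zero.1 h2 with h3 | h3
    · exact absurd h3 (by simp [Complex.I_ne_zero])
    · linear_combination h3
  have h2 : (s : ℝ) = t + n := by exact_mod_cast h1
  have hs := s.2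
  have ht := t.2
  have hn1 : (n : ℝ) ≤ 1 := by linarith [hs.2, ht.1]
  have hn2 : (-1 : ℝ) ≤ n := by linarith [hs.1, ht.2]
  have hn1' : n ≤ 1 := by exact_mod_cast hn1
  have hn2' : -1 ≤ n := by exact_mod_cast hn2
  obtain rfl | rfl | rfl : n = -1 ∨ n = 0 ∨ n = 1 := by omega
  · right; left
    push_cast at h2
    exact ⟨Subtype.ext (by rw [Icc.coe_zero]; linarith [hs.1, ht.2]),
      Subtype.ext (by rw [Icc.coe_one]; linarith [hs.1, ht.2])⟩
  · left
    exact Subtype.ext (by simpa using h2)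
  · right; right
    push_cast at h2
    exact ⟨Subtype.ext (by rw [Icc.coe_one]; linarith [hs.2, ht.1]),
      Subtype.ext (by rw [Icc.coe_zero]; linarith [hs.2, ht.1])⟩

/-- In a simply connected space, every closed curve bounds a disc. -/
theorem boundsDiscIn_univ {M : Type*} [TopologicalSpace M] [SimplyConnectedSpace M] {γ : ℝ → M}
    (hγ : Continuous γ) (hper : Function.Periodic γ 1) : BoundsDiscIn γ univ := by
  classical
  have h01 : γ 1 = γ 0 := by simpa using hper 0
  let c : Path (γ 0) (γ 0) :=
    { toFun := fun t => γ t
      continuous_toFun := by fun_prop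
      source' := by simp
      target' := by simpa using h01 }
  obtain ⟨H⟩ := SimplyConnectedSpace.paths_homotopic c (Path.refl (γ 0))
  -- The homotopy descends to the disc: at time `1` it is constant, which matches the centre, and
  -- its path endpoints stay fixed, which matches the seam.
  have hfac : ∀ w w', discPolar w = discPolar w' → H w = H w' := by
    rintro ⟨s, t⟩ ⟨s', t'⟩ h
    have h' := congrArg Subtype.val h
    simp only [discPolar] at h'
    have hs : s = s' := by
      have := congrArg norm h'
      have e : ∀ u : ℝ, ‖Complex.exp (2 * Real.pi * (u : ℂ) * Complex.I)‖ = 1 := fun u => by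
        have := Complex.norm_exp_ofReal_mul_I (2 * Real.pi * u)
        push_cast at this
        exact this
      rw [norm_mul, norm_mul, e, e, mul_one, mul_one, Complex.norm_real, Complex.norm_real,
        Real.norm_eq_abs, Real.norm_eq_abs, abs_of_nonneg (σ s).2.1, abs_of_nonneg (σ s').2.1] at this
      exact unitInterval.symm_bijective.1 (Subtype.ext this)
    subst hs
    rcases eq_or_ne s 1 with rfl | hs1
    · simp
    · have hne : ((σ s : ℝ) : ℂ) ≠ 0 := by
        simp only [unitInterval.coe_symm_eq, ne_eq, Complex.ofReal_eq_zero, sub_eq_zero]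
        exact fun h => hs1 (Subtype.ext h.symm)
      rcases exp_eq_exp_iff_of_mem_unitInterval (mul_left_cancel₀ hne h') with
        rfl | ⟨rfl, rfl⟩ | ⟨rfl, rfl⟩ <;> simp
  let f : C(Metric.closedBall (0 : ℂ) 1, M) :=
    IsQuotientMap.lift (f := ⟨discPolar, isQuotientMap_discPolar.continuous⟩)
      isQuotientMap_discPolar H.toContinuousMap fun {w w'} h => hfac w w' h
  have hf : ∀ w, f (discPolar w) = H w := fun w =>
    congrArg (fun F : C(I × I, M) => F w) (IsQuotientMap.lift_comp
      (f := ⟨discPolar, isQuotientMap_discPolar.continuous⟩)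
      isQuotientMap_discPolar H.toContinuousMap fun {w w'} h => hfac w w' h)
  refine ⟨fun z => if h : z ∈ Metric.closedBall (0 : ℂ) 1 then f ⟨z, h⟩ else γ 0, ?_,
    fun _ _ => mem_univ _, fun t => ?_⟩
  · rw [continuousOn_iff_continuous_domRestrict]
    exact f.continuous.congr fun z => by
      rw [domRestrict_apply, dif_pos z.2]
  · let u : I := ⟨Int.fract t, Int.fract_nonneg t, (Int.fract_lt_one t).le⟩
    have hexp : Complex.exp (2 * Real.pi * t * Complex.I) = (discPolar (0, u) : ℂ) := by
      simp only [discPolar, unitInterval.symm_zero, Icc.coe_one, Complex.ofReal_one, one_mul, u]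
      rw [Complex.exp_eq_exp_iff_exists_int]
      refine ⟨⌊t⌋, ?_⟩
      have : ((Int.fract t : ℝ) : ℂ) = t - ⌊t⌋ := by
        rw [Int.fract]
        push_cast
        rfl
      rw [this]
      ring
    have hγt : γ (Int.fract t) = γ t := by
      have := hper.sub_int_mul_eq (x := t) ⌊t⌋
      rw [mul_one] at this
      exact this
    simp only [hexp, Subtype.coe_prop, dif_pos, Subtype.coe_eta, hf]
    simp only [ContinuousMap.HomotopyWith.apply_zero]
    exact hγt

/-- A circle-valued function along the boundary of a disc has degree zero: if it is constant on
one half of the boundary, its real lift over the other half has equal values at the ends. -/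
theorem BoundsDiscIn.lift_eq {M : Type*} [TopologicalSpace M] {γ : ℝ → M} {Y : Set M}
    (hγ : BoundsDiscIn γ Y) {φ : M → AddCircle (1 : ℝ)} (hφ : ContinuousOn φ Y) {h : ℝ → ℝ}
    (hh : ContinuousOn h (Icc 0 (1 / 2))) (hφh : ∀ t ∈ Icc (0 : ℝ) (1 / 2), φ (γ t) = h t)
    {c : AddCircle (1 : ℝ)} (hc : ∀ t ∈ Icc (1 / 2 : ℝ) 1, φ (γ t) = c) : h 0 = h (1 / 2) := by
  obtain ⟨f, hf, hfY, hfγ⟩ := hγ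
  have hcov : IsCoveringMap ((↑) : ℝ → AddCircle (1 : ℝ)) := AddCircle.isCoveringMap_coe 1
  have : ContractibleSpace (Metric.closedBall (0 : ℂ) 1) :=
    (convex_closedBall (0 : ℂ) 1).contractibleSpace ⟨0, by simp⟩
  have : LocallyPathConnectedSpace (Metric.closedBall (0 : ℂ) 1) :=
    (convex_closedBall (0 : ℂ) 1).locallyPathConnectedSpace
  let F : C(Metric.closedBall (0 : ℂ) 1, AddCircle (1 : ℝ)) :=
    ⟨fun z => φ (f z), (hφ.comp hf hfY).domRestrict⟩
  obtain ⟨e₀, he₀⟩ := QuotientAddGroup.mk_surjective (F ⟨0, by simp⟩)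
  -- The disc is contractible, so the circle-valued map lifts to `θ : disc → ℝ`. On the boundary,
  -- `θ` is a translate of `h` over one half and constant over the other, and it returns to its
  -- initial value.
  obtain ⟨θ, ⟨-, hθ⟩, -⟩ := hcov.existsUnique_continuousMap_lifts F ⟨0, by simp⟩ e₀ he₀
  let b : ℝ → Metric.closedBall (0 : ℂ) 1 := fun t =>
    ⟨Complex.exp (2 * Real.pi * t * Complex.I), by
      have := Complex.norm_exp_ofReal_mul_I (2 * Real.pi * t)
      push_cast at this
      rw [mem_closedBall_zero_iff, this]⟩
  have hb : Continuous b := by fun_prop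
  have hθb : ∀ t, ((θ (b t) : ℝ) : AddCircle (1 : ℝ)) = φ (γ t) := fun t => by
    rw [← hfγ t]
    exact congrFun hθ (b t)
  have hb01 : b 1 = b 0 := Subtype.ext (by simp [b])
  have hcont : Continuous fun t => θ (b t) := θ.continuous.comp hb
  have h1 : EqOn (fun t => θ (b t)) (fun t => h t + (θ (b 0) - h 0)) (Icc 0 (1 / 2)) := by
    refine hcov.eqOn_of_comp_eqOn isPreconnected_Icc hcont.continuousOn (hh.add_const _)
      (fun t ht => ?_) (a := 0) ⟨le_rfl, by norm_num⟩ (by ring)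
    simp only [Function.comp_apply, AddCircle.coe_add, AddCircle.coe_sub, hθb, hφh t ht,
      hφh 0 ⟨le_rfl, by norm_num⟩, sub_self, add_zero]
  have h2 : θ (b (1 / 2)) = θ (b 1) := by
    refine hcov.constOn_of_comp isPreconnected_Icc hcont.continuousOn (s := Icc (1 / 2 : ℝ) 1)
      (fun t ht t' ht' => ?_) ⟨le_rfl, by norm_num⟩ ⟨by norm_num, le_rfl⟩
    simp only [hθb, hc t ht, hc t' ht']
  have h3 := h1 (x := 1 / 2) ⟨by norm_num, le_rfl⟩
  simp only [h2, hb01] at h3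
  linarith

end Discs

/-! ### Coarse geometry and the curve with large fill radius -/

section Coarse

/-- A function on the index set of a net that varies little between nearby points of the net is
approximated by a continuous function near the net. -/
theorem exists_continuousOn_approx {M G : Type*} [EMetricSpace M] (o : G → M) (T : G → ℝ)
    {s : ℝ≥0∞} {K : ℝ} (hT : ∀ g h, edist (o g) (o h) < s + s → |T g - T h| ≤ K) :
    ∃ P : M → ℝ, ContinuousOn P {x | ∃ g, edist x (o g) < s} ∧
      ∀ x g, edist x (o g) < s → |P x - T g| ≤ K := by
  classical
  let Y : Set M := {x | ∃ g, edist x (o g) < s}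
  -- The constraints at each point are convex, and near a point within `s` of `o g` the constant `T
  -- g` satisfies all of them; a partition of unity combines these local solutions.
  obtain ⟨P, hP⟩ := exists_continuous_forall_mem_convex_of_local_const (X := Y) (E := ℝ)
    (t := fun x => ⋂ g ∈ {g | edist x.1 (o g) < s}, Icc (T g - K) (T g + K))
    (fun x => convex_iInter₂ fun g _ => convex_Icc _ _) (by
      rintro ⟨x, g, hg⟩
      refine ⟨T g, ?_⟩
      have hopen : IsOpen {y : Y | edist y.1 (o g) < s} :=
        isOpen_lt (continuous_subtype_val.edist continuous_const) continuous_const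
      filter_upwards [hopen.mem_nhds hg] with y hy
      refine mem_iInter₂.2 fun h hh => ?_
      have hd : edist (o g) (o h) < s + s := by
        refine (edist_triangle_left (o g) (o h) y.1).trans_lt ?_
        exact ENNReal.add_lt_add hy hh
      have := abs_le.1 (hT g h hd)
      constructor <;> linarith [this.1, this.2])
  refine ⟨fun x => if h : x ∈ Y then P ⟨x, h⟩ else 0, ?_, fun x g hg => ?_⟩
  · rw [continuousOn_iff_continuous_domRestrict]
    exact P.continuous.congr fun z => by rw [domRestrict_apply, dif_pos z.2]
  · have hx : x ∈ Y := ⟨g, hg⟩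
    have := mem_iInter₂.1 (hP ⟨x, hx⟩) g hg
    simp only [dif_pos hx, abs_le]
    constructor <;> linarith [this.1, this.2]

/-- The union of the balls around a chain of points with small steps is connected. -/
theorem exists_isOpen_isPreconnected_of_chain {M G : Type*} [EMetricSpace M] (o : G → M)
    {D : ℝ≥0∞} (hball : ∀ x : M, IsPreconnected (Metric.eball x D)) (Q : G → Prop) {a b : G}
    (hD0 : 0 < D) (ha : Q a)
    (hab : Relation.ReflTransGen (fun g h => edist (o g) (o h) < D ∧ Q h) a b) :
    ∃ U : Set M, IsOpen U ∧ IsPreconnected U ∧ o a ∈ U ∧ o b ∈ U ∧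
      ∀ x ∈ U, ∃ g, Q g ∧ edist x (o g) < D := by
  induction hab with
  | refl => exact ⟨Metric.eball (o a) D, Metric.isOpen_eball, hball _, Metric.mem_eball_self hD0,
      Metric.mem_eball_self hD0, fun x hx => ⟨a, ha, hx⟩⟩
  | @tail b c _ hbc ih =>
    obtain ⟨U, hU, hUc, haU, hbU, hQ⟩ := ih
    refine ⟨U ∪ Metric.eball (o c) D, hU.union Metric.isOpen_eball, hUc.union (o b) hbU hbc.1
      (hball _), Or.inl haU, Or.inr (Metric.mem_eball_self hD0), ?_⟩
    rintro x (hx | hx)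
    · exact hQ x hx
    · exact ⟨c, hbc.2, hx⟩

/-- Truncation of a real number to `[-1/2, 1/2]`. -/
noncomputable def clamp (p : ℝ) : ℝ := max (-(1 / 2)) (min (1 / 2) p)

theorem continuous_clamp : Continuous clamp := by
  unfold clamp
  fun_prop

theorem clamp_of_le {p : ℝ} (hp : p ≤ -(1 / 2)) : clamp p = -(1 / 2) := by
  rw [clamp, min_eq_right (by linarith), max_eq_left hp]

theorem clamp_of_ge {p : ℝ} (hp : 1 / 2 ≤ p) : clamp p = 1 / 2 := by
  rw [clamp, min_eq_left hp, max_eq_right (by norm_num)]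

/-- The two ends of the truncation interval are identified in `ℝ/ℤ`; this turns truncated position
along the geodesic into a map that is constant away from its middle. -/
theorem coe_clamp {p : ℝ} (hp : 1 ≤ |p|) :
    (clamp p : AddCircle (1 : ℝ)) = ((1 / 2 : ℝ) : AddCircle (1 : ℝ)) := by
  rcases le_abs'.1 hp with h | h
  · rw [clamp_of_le (by linarith)]
    have : ((1 / 2 : ℝ) : AddCircle (1 : ℝ)) = ((-(1 / 2) + 1 : ℝ) : AddCircle (1 : ℝ)) := by
      norm_num
    rw [this, AddCircle.coe_add, AddCircle.coe_period, add_zero]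
  · rw [clamp_of_ge (by linarith)]

variable {E : Type*} [NormedAddCommGroup E] [NormedSpace ℝ E]
  {M : Type*} [EMetricSpace M] [ChartedSpace E M] [IsManifold 𝓘(ℝ, E) ∞ M]

/-- Two smooth arcs `α`, `β` with the same endpoints contain a simple closed curve which crosses
from the region where `P` is negative to the region where `P` is positive along `α`, and returns
along `β`. -/
theorem exists_crossing_curve {α β : ℝ → M} {x y : M} (hα : IsFlatArc (E := E) α x y)
    (hβ : IsFlatArc (E := E) β x y) {p : ℝ → ℝ} (hp : Continuous p) (hp0 : p 0 ≤ 0) (hp1 : 0 ≤ p 1)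
    (hhit : ∀ t ∈ Icc (0 : ℝ) 1, α t ∈ β '' Icc 0 1 → 1 ≤ |p t|) :
    ∃ (γ : ℝ → M) (τ : ℝ → ℝ), IsSmoothSimpleClosedCurve 𝓘(ℝ, E) γ ∧ Continuous τ ∧
      (∀ t, τ t ∈ Icc (0 : ℝ) 1) ∧ (∀ t ∈ Icc (0 : ℝ) (1 / 2), γ t = α (τ t)) ∧
      (∀ t ∈ Icc (1 / 2 : ℝ) 1, γ t ∈ β '' Icc 0 1) ∧
      range γ ⊆ α '' Icc 0 1 ∪ β '' Icc 0 1 ∧ p (τ 0) ≤ -1 ∧ 1 ≤ p (τ (1 / 2)) := by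
  set H : Set ℝ := Icc (0 : ℝ) 1 ∩ α ⁻¹' (β '' Icc 0 1) with hH
  have hHcl : IsClosed H :=
    isClosed_Icc.inter (hβ.isCompact_image.isClosed.preimage hα.smooth.continuous)
  have hHcpt : IsCompact H := isCompact_Icc.of_isClosed_subset hHcl inter_subset_left
  have h0H : (0 : ℝ) ∈ H := ⟨by norm_num, 0, by norm_num, by rw [hα.zero, hβ.zero]⟩
  have h1H : (1 : ℝ) ∈ H := ⟨by norm_num, 1, by norm_num, by rw [hα.one, hβ.one]⟩
  -- `b` is the first meeting time with `p ≥ 0`, and `a` the last one before it with `p ≤ 0`. Hence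
  -- `α` does not meet `β` strictly between `a` and `b`, and `|p| ≥ 1` at both times.
  obtain ⟨b, ⟨hbH, hpb⟩, hbmin⟩ :=
    (hHcpt.inter_right (isClosed_le continuous_const hp)).exists_isLeast ⟨1, h1H, hp1⟩
  obtain ⟨a, ⟨⟨haH, hpa⟩, hab⟩, hamax⟩ := ((hHcpt.inter_right
    (isClosed_le hp continuous_const)).inter_right (isClosed_Iic (a := b))).exists_isGreatest
    ⟨0, ⟨h0H, hp0⟩, hbH.1.1⟩
  have hpa1 : p a ≤ -1 := by
    rcases le_abs'.1 (hhit a haH.1 haH.2) with h | h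
    · exact h
    · exact absurd (le_trans h hpa) (by norm_num)
  have hpb1 : 1 ≤ p b := by
    rcases le_abs'.1 (hhit b hbH.1 hbH.2) with h | h
    · exact absurd (le_trans hpb h) (by norm_num)
    · exact h
  have hne : a ≠ b := by
    rintro rfl
    linarith
  have hbetween : ∀ u ∈ H, u ∈ Icc a b → u = a ∨ u = b := by
    intro u hu hu'
    rcases le_total (p u) 0 with h | h
    · exact Or.inl (le_antisymm (hamax ⟨⟨hu, h⟩, hu'.2⟩) hu'.1)
    · exact Or.inr (le_antisymm hu'.2 (hbmin ⟨hu, h⟩))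
  obtain ⟨ha01, a', ha', haa'⟩ := haH
  obtain ⟨hb01, b', hb', hbb'⟩ := hbH
  have hne' : b' ≠ a' := by
    rintro rfl
    exact hne (hα.inj ha01 hb01 (haa'.symm.trans hbb'))
  have hA := hα.restrict ha01 hb01 hne
  have hB := hβ.restrict hb' ha' hne'
  rw [hbb', haa'] at hB
  obtain ⟨γ, hγ, hγA, hγB, hγr⟩ := hA.exists_isSmoothSimpleClosedCurve hB (by
    intro u hu v hv huv
    have hu' := IsFlatArc.ramp_mem_uIcc a b u
    have hv' := uIcc_subset_Icc hb' ha' (IsFlatArc.ramp_mem_uIcc b' a' v)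
    have huH : IsFlatArc.ramp a b u ∈ H :=
      ⟨uIcc_subset_Icc ha01 hb01 hu', _, hv', huv.symm⟩
    rw [uIcc_of_le hab] at hu'
    simp only [Function.comp_apply] at huv
    rcases hbetween _ huH hu' with h | h
    · right
      refine IsFlatArc.injOn_ramp hne' hv (by norm_num) (hβ.inj hv' ?_ ?_)
      · rw [IsFlatArc.ramp_of_one_le _ _ le_rfl]
        exact ha'
      · rw [← huv, h, IsFlatArc.ramp_of_one_le _ _ le_rfl, haa']
    · left
      refine IsFlatArc.injOn_ramp hne' hv (by norm_num) (hβ.inj hv' ?_ ?_)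
      · rw [IsFlatArc.ramp_of_nonpos _ _ le_rfl]
        exact hb'
      · rw [← huv, h, IsFlatArc.ramp_of_nonpos _ _ le_rfl, hbb'])
  refine ⟨γ, fun t => IsFlatArc.ramp a b (2 * t), hγ, ?_, fun t => ?_, hγA, fun t ht => ?_, ?_, ?_, ?_⟩
  · exact (IsFlatArc.contDiff_ramp a b).continuous.comp (by fun_prop)
  · exact uIcc_subset_Icc ha01 hb01 (IsFlatArc.ramp_mem_uIcc a b _)
  · rw [hγB t ht]
    exact ⟨_, uIcc_subset_Icc hb' ha' (IsFlatArc.ramp_mem_uIcc b' a' _), rfl⟩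
  · refine hγr.trans (union_subset_union ?_ ?_)
    · exact (IsFlatArc.image_comp_ramp_subset _ _ _ _).trans (image_mono (uIcc_subset_Icc ha01 hb01))
    · exact (IsFlatArc.image_comp_ramp_subset _ _ _ _).trans (image_mono (uIcc_subset_Icc hb' ha'))
  · simpa [IsFlatArc.ramp_of_nonpos] using hpa1
  · have h : IsFlatArc.ramp a b (2 * (1 / 2)) = b := IsFlatArc.ramp_of_one_le _ _ (by norm_num)
    simpa only [h] using hpb1

/-- A closed curve with fill radius at most `C` bounds a disc in each larger neighbourhood. -/
theorem boundsDiscIn_of_fillRadius_lt {γ : ℝ → M} {r : ℝ≥0} (h : fillRadius γ < r) :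
    BoundsDiscIn γ (Metric.cthickening (r : ℝ) (range γ)) := by
  by_contra hn
  exact absurd (le_iSup₂_of_le (f := fun (r : ℝ≥0)
    (_ : ¬ BoundsDiscIn γ (Metric.cthickening (r : ℝ) (range γ))) => (r : ℝ≥0∞)) r hn le_rfl)
    (not_le.2 h)

theorem BoundsDiscIn.mono {γ : ℝ → M} {S T : Set M} (h : BoundsDiscIn γ S) (hST : S ⊆ T) :
    BoundsDiscIn γ T := by
  obtain ⟨f, hf, hfS, hfγ⟩ := h
  exact ⟨f, hf, hfS.mono_right hST, hfγ⟩

/-- A simply connected manifold containing a proper coarse image of an infinite, coarsely one-ended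
group does not have bounded fill radius. -/
theorem not_hasBoundedFillRadius [SimplyConnectedSpace M] {G : Type*} [Group G] [Infinite G]
    {ℓ : G → ℕ} (hℓ : IsWordLength ℓ)
    (hone : ∀ n, ∃ m, ∀ g h, m < ℓ g → m < ℓ h →
      Relation.ReflTransGen (IsWordLength.StepOutside ℓ n) g h)
    (hball : ∀ (x : M) (r : ℝ≥0∞), IsPreconnected (Metric.eball x r))
    (o : G → M) {D : ℝ≥0} (hD : ∀ g h, ℓ (g⁻¹ * h) ≤ 1 → edist (o g) (o h) < D)
    (hprop : ∀ r : ℝ≥0, ∃ K : ℕ, ∀ g h, edist (o g) (o h) < r → ℓ (g⁻¹ * h) ≤ K) :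
    ¬ HasBoundedFillRadius 𝓘(ℝ, E) M := by
  rintro ⟨C, hC⟩
  have hD0 : (0 : ℝ≥0∞) < D := zero_le.trans_lt (hD 1 1 (by simp [hℓ.one]))
  -- `C + 1` is the size of the neighbourhood containing the disc, the second `1` turns its closed
  -- condition into a point of the curve at smaller distance, and `D` is the distance from the curve
  -- to its chain.
  set s : ℝ≥0 := C + 1 + 1 + D with hs
  have hDs : (D : ℝ≥0∞) ≤ s := by
    rw [hs]
    exact_mod_cast le_add_of_nonneg_left zero_le
  obtain ⟨K, hK⟩ := hprop (s + s)
  -- Word length above `3K + 2` leaves `V ≥ 2K + 3` near `β` after the error `K`, above the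
  -- threshold `2K + 1` used for `φ`.
  obtain ⟨m, hm⟩ := hone (3 * K + 2)
  -- The ends of the geodesic must lie beyond `m`, and `P` must be at most `-1` and at least `1`
  -- there despite the error `K`.
  set L : ℕ := m + K + 1 with hL
  obtain ⟨g₀, hg₀⟩ := hℓ.exists_eq (2 * L)
  obtain ⟨v, -, hvℓ, hvd⟩ := hℓ.exists_geodesic _ g₀ hg₀
  -- Left translation moves the midpoint of the geodesic to `1`.
  set a : ℕ → G := fun i => (v L)⁻¹ * v i with ha
  have ha0 : m < ℓ (a 0) := by
    have h1 := hℓ.le_add (v L) (v 0)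
    rw [hvℓ L (by omega), hvℓ 0 (by omega)] at h1
    simp only [ha]
    omega
  have ha2 : m < ℓ (a (2 * L)) := by
    have h1 := hℓ.le_add (v (2 * L)) (v L)
    rw [hvℓ L (by omega), hvℓ (2 * L) le_rfl, hℓ.comm] at h1
    simp only [ha]
    omega
  have hstep : ∀ i j, (a i)⁻¹ * a j = (v i)⁻¹ * v j := fun i j => by
    simp only [ha]
    group
  -- Word distance from `(v L)⁻¹`, shifted by `L`: along the geodesic this is the signed position `i
  -- - L`.
  let T : G → ℝ := fun g => (ℓ (v L * g) : ℝ) - L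
  have hTa : ∀ i ≤ 2 * L, T (a i) = (i : ℝ) - L := fun i hi => by
    simp only [T, ha, mul_inv_cancel_left, hvℓ i hi]
  have hℓa : ∀ i ≤ 2 * L, (ℓ (a i) : ℝ) ≤ |(i : ℝ) - L| := by
    intro i hi
    rcases le_total i L with h | h
    · have h1 := hvd i L h (by omega)
      rw [hℓ.comm] at h1
      have h2 : (ℓ (a i) : ℝ) ≤ ((L - i : ℕ) : ℝ) := by exact_mod_cast h1
      rw [Nat.cast_sub h] at h2
      rw [abs_sub_comm]
      exact h2.trans (le_abs_self _)
    · have h1 := hvd L i h hi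
      have h2 : (ℓ (a i) : ℝ) ≤ ((i - L : ℕ) : ℝ) := by exact_mod_cast h1
      rw [Nat.cast_sub h] at h2
      exact h2.trans (le_abs_self _)
  have hlip : ∀ g h, |(ℓ g : ℝ) - ℓ h| ≤ ℓ (g⁻¹ * h) := by
    intro g h
    have h1 : (ℓ g : ℝ) ≤ ℓ h + ℓ (g⁻¹ * h) := by exact_mod_cast hℓ.le_add g h
    have h2 : (ℓ h : ℝ) ≤ ℓ g + ℓ (h⁻¹ * g) := by exact_mod_cast hℓ.le_add h g
    rw [hℓ.comm h g] at h2
    rw [abs_le]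
    constructor <;> linarith
  have hTlip : ∀ g h, |T g - T h| ≤ ℓ (g⁻¹ * h) := by
    intro g h
    have h1 := hlip (v L * g) (v L * h)
    have h2 : (v L * g)⁻¹ * (v L * h) = g⁻¹ * h := by group
    rw [h2] at h1
    simpa [T] using h1
  have hKs : ∀ g h, edist (o g) (o h) < (s : ℝ≥0∞) + s → (ℓ (g⁻¹ * h) : ℝ) ≤ K := by
    intro g h hgh
    exact_mod_cast hK g h (by exact_mod_cast hgh)
  obtain ⟨P, hPc, hP⟩ := exists_continuousOn_approx o T (s := s) (K := K)
    fun g h hgh => (hTlip g h).trans (hKs g h hgh)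
  obtain ⟨V, hVc, hV⟩ := exists_continuousOn_approx o (fun g => (ℓ g : ℝ)) (s := s) (K := K)
    fun g h hgh => (hlip g h).trans (hKs g h hgh)
  set Qα : G → Prop := fun g => ∃ i ≤ 2 * L, g = a i
  set Qβ : G → Prop := fun g => 3 * K + 2 < ℓ g
  obtain ⟨Uα, hUα, hUαc, h0α, h1α, hQα⟩ := exists_isOpen_isPreconnected_of_chain o
    (fun x => hball x D) Qα (a := a 0) (b := a (2 * L)) hD0 ⟨0, by omega, rfl⟩ (by
      have : ∀ i ≤ 2 * L, Relation.ReflTransGen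
          (fun g h => edist (o g) (o h) < D ∧ Qα h) (a 0) (a i) := by
        intro i
        induction i with
        | zero => exact fun _ => .refl
        | succ i ih =>
          intro hi
          refine (ih (by omega)).tail ⟨hD _ _ ?_, i + 1, hi, rfl⟩
          have := hvd i (i + 1) (by omega) hi
          rw [hstep]
          omega
      exact this _ le_rfl)
  have hchain := hm (a 0) (a (2 * L)) ha0 ha2
  have hQβ0 : Qβ (a 0) := by
    rcases hchain.cases_head with h | ⟨c, hc, -⟩
    · exfalso
      have h1 := hTa 0 (by omega)
      rw [h, hTa (2 * L) le_rfl] at h1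
      push_cast at h1
      have : (0 : ℝ) < L := by rw [hL]; positivity
      linarith
    · exact hc.1
  obtain ⟨Uβ, hUβ, hUβc, h0β, h1β, hQβ⟩ := exists_isOpen_isPreconnected_of_chain o
    (fun x => hball x D) Qβ hD0 hQβ0 (Relation.ReflTransGen.mono
      (fun g h hgh => ⟨hD g h hgh.2.2, hgh.2.1⟩) _ _ hchain)
  have hKpos : (0 : ℝ) ≤ K := Nat.cast_nonneg K
  have hLK : (K : ℝ) + 1 ≤ L := by
    have : K + 1 ≤ L := by omega
    exact_mod_cast this
  have hP0 : P (o (a 0)) ≤ -1 := by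
    have h1 := abs_le.1 (hP (o (a 0)) (a 0) (by simpa using hD0.trans_le hDs))
    rw [hTa 0 (by omega)] at h1
    push_cast at h1
    linarith [h1.2]
  have hP1 : 1 ≤ P (o (a (2 * L))) := by
    have h1 := abs_le.1 (hP (o (a (2 * L))) (a (2 * L)) (by simpa using hD0.trans_le hDs))
    rw [hTa (2 * L) le_rfl] at h1
    push_cast at h1
    linarith [h1.1]
  have hne : o (a 0) ≠ o (a (2 * L)) := by
    intro h
    rw [h] at hP0
    linarith
  obtain ⟨α, hα, hαU⟩ := IsFlatArc.exists_of_isPreconnected (E := E) hUα hUαc h0α h1α hne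
  obtain ⟨β, hβ, hβU⟩ := IsFlatArc.exists_of_isPreconnected (E := E) hUβ hUβc h0β h1β hne
  -- the coarse shape of `P` and `V` near the two chains
  have hPVα : ∀ x g, Qα g → edist x (o g) < s → V x - 2 * K ≤ |P x| := by
    rintro x g ⟨i, hi, rfl⟩ hx
    have h1 := hP x _ hx
    have h2 := abs_le.1 (hV x _ hx)
    have h3 := hℓa i hi
    rw [hTa i hi] at h1
    -- Word length on the geodesic is at most the absolute position; replacing both by their
    -- approximations costs `K` each.
    have h4 := abs_sub_abs_le_abs_sub ((i : ℝ) - L) (P x)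
    rw [abs_sub_comm _ (P x)] at h4
    linarith [h2.2]
  have hVβ : ∀ x g, Qβ g → edist x (o g) < s → 2 * K + 3 ≤ V x := by
    intro x g hg hx
    have h2 := abs_le.1 (hV x _ hx)
    have h3 : ((3 * K + 2 + 1 : ℕ) : ℝ) ≤ ℓ g := by exact_mod_cast hg
    push_cast at h3
    linarith [h2.1]
  set Y : Set M := {x | ∃ g, (Qα g ∨ Qβ g) ∧ edist x (o g) < s} with hY
  have hYsub : Y ⊆ {x | ∃ g, edist x (o g) < s} := fun x ⟨g, _, hg⟩ => ⟨g, hg⟩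
  set φ : M → AddCircle (1 : ℝ) := fun x =>
    if V x ≤ 2 * K + 1 then (clamp (P x) : AddCircle (1 : ℝ)) else ((1 / 2 : ℝ) : AddCircle (1 : ℝ))
  have hφ : ContinuousOn φ Y := by
    rw [continuousOn_iff_continuous_domRestrict]
    have hPY : Continuous fun x : Y => P x := (hPc.mono hYsub).domRestrict
    have hVY : Continuous fun x : Y => V x := (hVc.mono hYsub).domRestrict
    -- On the interface `V = 2K + 1`, a point near the geodesic has `|P| ≥ 1`, so both formulas give
    -- `1/2`; near the outer chain the interface is empty.
    refine Continuous.if_le (f' := fun x : Y => (clamp (P x) : AddCircle (1 : ℝ)))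
      (g' := fun _ => ((1 / 2 : ℝ) : AddCircle (1 : ℝ)))
      ((AddCircle.continuous_mk' 1).comp (continuous_clamp.comp hPY)) continuous_const hVY
      continuous_const ?_
    rintro ⟨x, g, hg | hg, hx⟩ hVx
    · refine coe_clamp ?_
      have := hPVα x g hg hx
      simp only at hVx
      linarith
    · have := hVβ x g hg hx
      simp only at hVx
      linarith
  have hφα : ∀ x ∈ Uα, φ x = (clamp (P x) : AddCircle (1 : ℝ)) := by
    intro x hx
    obtain ⟨g, hg, hxg⟩ := hQα x hx
    simp only [φ]
    split_ifs with h
    · rfl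
    · refine (coe_clamp ?_).symm
      have := hPVα x g hg (hxg.trans_le hDs)
      linarith [not_le.1 h]
  have hφβ : ∀ x ∈ Uβ, φ x = ((1 / 2 : ℝ) : AddCircle (1 : ℝ)) := by
    intro x hx
    obtain ⟨g, hg, hxg⟩ := hQβ x hx
    have := hVβ x g hg (hxg.trans_le hDs)
    exact if_neg (by linarith)
  have hαmem : ∀ t, α t ∈ Uα := by
    intro t
    rcases le_total t 0 with h | h
    · rw [hα.left t h]
      exact h0α
    · rcases le_total 1 t with h' | h'
      · rw [hα.right t h']
        exact h1α
      · exact hαU ⟨t, ⟨h, h'⟩, rfl⟩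
  have hUαY : Uα ⊆ {x | ∃ g, edist x (o g) < s} := fun x hx => by
    obtain ⟨g, -, hg⟩ := hQα x hx
    exact ⟨g, hg.trans_le hDs⟩
  have hp : Continuous fun t => P (α t) :=
    (hPc.mono hUαY).comp_continuous hα.smooth.continuous hαmem
  obtain ⟨γ, τ, hγ, hτ, hτ01, hγα, hγβ, hγr, hτ0, hτ1⟩ := exists_crossing_curve hα hβ hp
    (by simp only [hα.zero]; linarith) (by simp only [hα.one]; linarith) (by
      intro t ht htβ
      obtain ⟨g, hg, hxg⟩ := hQα _ (hαmem t)
      obtain ⟨g', hg', hxg'⟩ := hQβ _ (hβU htβ)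
      have h1 := hPVα _ g hg (hxg.trans_le hDs)
      have h2 := hVβ _ g' hg' (hxg'.trans_le hDs)
      linarith)
  have hfill : fillRadius γ < (C + 1 : ℝ≥0) := by
    refine (hC γ hγ (boundsDiscIn_univ hγ.1.continuous hγ.2.1)).trans_lt ?_
    exact_mod_cast lt_add_one C
  have hdisc := boundsDiscIn_of_fillRadius_lt hfill
  have hsub : Metric.cthickening ((C + 1 : ℝ≥0) : ℝ) (range γ) ⊆ Y := by
    intro x hx
    rw [Metric.mem_cthickening_iff, ENNReal.ofReal_coe_nnreal] at hx
    have hlt : Metric.infEDist x (range γ) < (C + 1 + 1 : ℝ≥0) :=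
      hx.trans_lt (by exact_mod_cast lt_add_one (C + 1))
    obtain ⟨y, hy, hxy⟩ := Metric.infEDist_lt_iff.1 hlt
    have hfin : ∀ g, edist y (o g) < D → edist x (o g) < s := by
      intro g hg
      refine (edist_triangle x y (o g)).trans_lt ?_
      rw [hs, ENNReal.coe_add]
      exact ENNReal.add_lt_add hxy hg
    rcases hγr hy with hy | hy
    · obtain ⟨g, hg, hyg⟩ := hQα y (hαU hy)
      exact ⟨g, Or.inl hg, hfin g hyg⟩
    · obtain ⟨g, hg, hyg⟩ := hQβ y (hβU hy)
      exact ⟨g, Or.inr hg, hfin g hyg⟩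
  -- The lift over the `α` half runs from `-1/2` to `1/2` while the `β` half is constant,
  -- contradicting degree zero.
  have hend := (hdisc.mono hsub).lift_eq hφ (h := fun t => clamp (P (α (τ t))))
    (continuous_clamp.comp (hp.comp hτ)).continuousOn
    (fun t ht => by rw [hγα t ht, hφα _ (hαmem _)])
    (fun t ht => hφβ _ (hβU (hγβ t ht)))
  rw [clamp_of_le (by linarith), clamp_of_ge (by linarith)] at hend
  norm_num at hend

end Coarse

/-! ### Lifting regularity of curves -/

section LocalIsometry

variable {E : Type*} [NormedAddCommGroup E] [NormedSpace ℝ E] [FiniteDimensional ℝ E]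
  {M : Type*} [TopologicalSpace M] [ChartedSpace E M] [IsManifold 𝓘(ℝ, E) ∞ M]
  {M' : Type*} [TopologicalSpace M'] [ChartedSpace E M'] [IsManifold 𝓘(ℝ, E) ∞ M']

/-- A continuous lift of a `C¹` curve through a local homeomorphism that is a smooth immersion is
`C¹`. -/
theorem contMDiff_of_comp {p : M → M'} (hp : ContMDiff 𝓘(ℝ, E) 𝓘(ℝ, E) ∞ p)
    (hloc : IsLocalHomeomorph p)
    (hinj : ∀ x, Function.Injective (mfderiv 𝓘(ℝ, E) 𝓘(ℝ, E) p x)) {c : ℝ → M}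
    (hc : Continuous c) (hpc : ContMDiff 𝓘(ℝ, ℝ) 𝓘(ℝ, E) 1 (p ∘ c)) :
    ContMDiff 𝓘(ℝ, ℝ) 𝓘(ℝ, E) 1 c := by
  intro t
  obtain ⟨e, hxe, hpe⟩ := hloc (c t)
  set x := c t with hx
  -- `Q` is `p` in charts. Its derivative is an injective endomorphism in finite dimension, hence
  -- invertible, so the local inverse is `C¹` and carries the regularity of `p ∘ c` back to `c`.
  set Q : OpenPartialHomeomorph E E := (chartAt E x).symm.trans (e.trans (chartAt E (p x))) with hQ
  have hQeq : ∀ u, Q u = chartAt E (p x) (p ((chartAt E x).symm u)) := fun u => by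
    simp [hQ, hpe]
  have hxs : x ∈ (chartAt E x).source := mem_chart_source E x
  have hpxs : p x ∈ (chartAt E (p x)).source := mem_chart_source E (p x)
  have hQsrc : chartAt E x x ∈ Q.source := by
    simp [hQ, hxe, ← hpe]
  have hQx : Q (chartAt E x x) = chartAt E (p x) (p x) := by
    rw [hQeq, (chartAt E x).left_inv hxs]
  have hQtgt : chartAt E (p x) (p x) ∈ Q.target := hQx ▸ Q.map_source hQsrc
  have hQsymm : Q.symm (chartAt E (p x) (p x)) = chartAt E x x := by
    rw [← hQx, Q.left_inv hQsrc]
  have hcd : ContDiffAt ℝ ∞ Q (chartAt E x x) := by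
    have h := (contMDiffAt_iff.1 (hp.contMDiffAt (x := x))).2
    simp only [modelWithCornersSelf_coe, range_id, contDiffWithinAt_univ] at h
    refine h.congr_of_eventuallyEq (Eventually.of_forall fun u => ?_)
    simp [hQeq]
  obtain ⟨D, hDp⟩ : ∃ D : E →L[ℝ] E, D = mfderiv 𝓘(ℝ, E) 𝓘(ℝ, E) p x := ⟨_, rfl⟩
  have hDinj : Function.Injective D := hDp ▸ hinj x
  have hfd : HasFDerivAt Q D (chartAt E x x) := by
    have h : HasFDerivWithinAt (writtenInExtChartAt 𝓘(ℝ, E) 𝓘(ℝ, E) x p) D (range 𝓘(ℝ, E))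
        (extChartAt 𝓘(ℝ, E) x x) :=
      hDp ▸ (hp.mdifferentiableAt (x := x) (by simp)).hasMFDerivAt.2
    refine (h.hasFDerivAt (by simp)).congr_of_eventuallyEq (Eventually.of_forall fun u => ?_)
    simp [hQeq, writtenInExtChartAt]
  let Le : E ≃L[ℝ] E := (LinearEquiv.ofInjectiveEndo (D : E →ₗ[ℝ] E) hDinj).toContinuousLinearEquiv
  have hLe : (Le : E →L[ℝ] E) = D := by
    ext u
    rfl
  have hsymm : ContDiffAt ℝ 1 Q.symm (chartAt E (p x) (p x)) := by
    refine Q.contDiffAt_symm (f₀' := Le) hQtgt ?_ ?_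
    · rw [hQsymm, hLe]
      exact hfd
    · rw [hQsymm]
      exact hcd.of_le (by exact_mod_cast le_top)
  have h1 : ContMDiffAt 𝓘(ℝ, ℝ) 𝓘(ℝ, E) 1 (fun s => chartAt E (p x) (p (c s))) t := by
    have hch : ContMDiffAt 𝓘(ℝ, E) 𝓘(ℝ, E) 1 (chartAt E (p x)) (p (c t)) :=
      contMDiffAt_of_mem_maximalAtlas (IsManifold.chart_mem_maximalAtlas (p x)) hpxs
    exact ContMDiffAt.comp (f := fun s => p (c s)) t hch hpc.contMDiffAt
  have h2 : ContMDiffAt 𝓘(ℝ, ℝ) 𝓘(ℝ, E) 1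
      (fun s => Q.symm (chartAt E (p x) (p (c s)))) t :=
    ContMDiffAt.comp (f := fun s => chartAt E (p x) (p (c s))) t hsymm.contMDiffAt h1
  have h3 : ContMDiffAt 𝓘(ℝ, ℝ) 𝓘(ℝ, E) 1
      (fun s => (chartAt E x).symm (Q.symm (chartAt E (p x) (p (c s))))) t := by
    have hch : ContMDiffAt 𝓘(ℝ, E) 𝓘(ℝ, E) 1 (chartAt E x).symm
        (Q.symm (chartAt E (p x) (p (c t)))) := by
      refine contMDiffAt_symm_of_mem_maximalAtlas (IsManifold.chart_mem_maximalAtlas x) ?_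
      rw [← hx, hQsymm]
      exact mem_chart_target E x
    exact ContMDiffAt.comp (f := fun s => Q.symm (chartAt E (p x) (p (c s)))) t hch h2
  refine h3.congr_of_eventuallyEq ?_
  have hev1 : ∀ᶠ s in 𝓝 t, c s ∈ (chartAt E x).source :=
    hc.continuousAt.preimage_mem_nhds ((chartAt E x).open_source.mem_nhds hxs)
  have hev2 : ∀ᶠ s in 𝓝 t, c s ∈ e.source :=
    hc.continuousAt.preimage_mem_nhds (e.open_source.mem_nhds hxe)
  have hev3 : ∀ᶠ s in 𝓝 t, p (c s) ∈ (chartAt E (p x)).source :=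
    hpc.continuous.continuousAt.preimage_mem_nhds
      ((chartAt E (p x)).open_source.mem_nhds hpxs)
  filter_upwards [hev1, hev2, hev3] with s hs1 hs2 hs3
  have hsrc : chartAt E x (c s) ∈ Q.source := by
    have hs3' : e (c s) ∈ (chartAt E (p x)).source := hpe ▸ hs3
    simp [hQ, hs1, hs2, hs3']
  have : chartAt E (p x) (p (c s)) = Q (chartAt E x (c s)) := by
    rw [hQeq, (chartAt E x).left_inv hs1]
  rw [this, Q.left_inv hsrc, (chartAt E x).left_inv hs1]

end LocalIsometry

/-! ### Length-space properties and isometries -/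

section Riemannian

variable {E : Type*} [NormedAddCommGroup E] [NormedSpace ℝ E]
  {M : Type*} [EMetricSpace M] [ChartedSpace E M]
  [RiemannianBundle (fun x : M => TangentSpace 𝓘(ℝ, E) x)]
  [IsRiemannianManifold 𝓘(ℝ, E) M]

/-- The distance is the infimum of the lengths of curves. -/
theorem exists_curve_of_edist_lt {x y : M} {r : ℝ≥0∞} (h : edist x y < r) :
    ∃ c : ℝ → M, ContMDiff 𝓘(ℝ, ℝ) 𝓘(ℝ, E) 1 c ∧ c 0 = x ∧ c 1 = y ∧
      pathELength 𝓘(ℝ, E) c 0 1 < r := by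
  rw [IsRiemannianManifold.out (I := 𝓘(ℝ, E))] at h
  obtain ⟨c, h0, h1, hc, hl, -, -⟩ :=
    exists_lt_locally_constant_of_riemannianEDist_lt h zero_lt_one
  exact ⟨c, hc, h0, h1, hl⟩

theorem edist_le_pathELength {c : ℝ → M} (hc : ContMDiff 𝓘(ℝ, ℝ) 𝓘(ℝ, E) 1 c) {a b : ℝ}
    (hab : a ≤ b) : edist (c a) (c b) ≤ pathELength 𝓘(ℝ, E) c a b := by
  rw [IsRiemannianManifold.out (I := 𝓘(ℝ, E))]
  exact riemannianEDist_le_pathELength hc.contMDiffOn rfl rfl hab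

/-- A curve from the centre of length less than `r` stays in the ball, since its initial pieces are
no longer than the whole. -/
theorem isPreconnected_eball (E : Type*) [NormedAddCommGroup E] [NormedSpace ℝ E]
    {M : Type*} [EMetricSpace M] [ChartedSpace E M]
    [RiemannianBundle (fun x : M => TangentSpace 𝓘(ℝ, E) x)]
    [IsRiemannianManifold 𝓘(ℝ, E) M]
    (x : M) (r : ℝ≥0∞) : IsPreconnected (Metric.eball x r) := by
  refine isPreconnected_of_forall x fun y hy => ?_
  obtain ⟨c, hc, h0, h1, hl⟩ := exists_curve_of_edist_lt (E := E) (Metric.mem_eball'.1 hy)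
  refine ⟨c '' Icc 0 1, ?_, ⟨0, by norm_num, h0⟩, ⟨1, by norm_num, h1⟩,
    isPreconnected_Icc.image _ hc.continuous.continuousOn⟩
  rintro _ ⟨t, ht, rfl⟩
  rw [Metric.mem_eball']
  calc edist x (c t) = edist (c 0) (c t) := by rw [h0]
    _ ≤ pathELength 𝓘(ℝ, E) c 0 t := edist_le_pathELength hc ht.1
    _ ≤ pathELength 𝓘(ℝ, E) c 0 1 := pathELength_mono le_rfl ht.2
    _ < r := hl

/-- Points almost between two given points. -/
theorem exists_edist_le_of_edist_lt_add (E : Type*) [NormedAddCommGroup E] [NormedSpace ℝ E]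
    {M : Type*} [EMetricSpace M] [ChartedSpace E M]
    [RiemannianBundle (fun x : M => TangentSpace 𝓘(ℝ, E) x)]
    [IsRiemannianManifold 𝓘(ℝ, E) M]
    {x y : M} {a b : ℝ≥0∞} (ha : a ≠ ⊤) (hb : 0 < b)
    (h : edist x y < a + b) : ∃ z, edist x z ≤ a ∧ edist z y < b := by
  rcases le_total (edist x y) a with hle | hle
  · exact ⟨y, hle, by simpa using hb⟩
  obtain ⟨c, hc, h0, h1, hl⟩ := exists_curve_of_edist_lt (E := E) h
  have hcont : ContinuousOn (fun t => edist x (c t)) (Icc 0 1) :=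
    (continuous_const.edist hc.continuous).continuousOn
  -- Stop at a point at distance exactly `a` from `x`: at least `a` of the length is spent, so less
  -- than `b` remains.
  obtain ⟨t, ht, hta⟩ := intermediate_value_Icc zero_le_one hcont
    (show a ∈ Icc (edist x (c 0)) (edist x (c 1)) from ⟨by simp [h0], by rwa [h1]⟩)
  refine ⟨c t, le_of_eq hta, ?_⟩
  rw [← pathELength_add ht.1 ht.2] at hl
  have h2 : a ≤ pathELength 𝓘(ℝ, E) c 0 t := by
    rw [← hta]
    simpa [h0] using edist_le_pathELength hc ht.1
  have h3 : edist (c t) y ≤ pathELength 𝓘(ℝ, E) c t 1 := by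
    simpa [h1] using edist_le_pathELength hc ht.2
  have h4 : a + edist (c t) y < a + b := (add_le_add h2 h3).trans_lt hl
  exact (ENNReal.add_lt_add_iff_left ha).1 h4

variable [FiniteDimensional ℝ E] [IsManifold 𝓘(ℝ, E) ∞ M]
  {M' : Type*} [TopologicalSpace M'] [ChartedSpace E M'] [IsManifold 𝓘(ℝ, E) ∞ M']
  [RiemannianBundle (fun x : M' => TangentSpace 𝓘(ℝ, E) x)]

/-- Lifts of the identity through a local isometry do not increase distances. -/
theorem edist_le_of_comp_eq {p : M → M'} (hloc : IsLocalHomeomorph p)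
    (hp : IsLocalRiemannianIsometry 𝓘(ℝ, E) p) {f : M → M} (hf : Continuous f)
    (hpf : ∀ x, p (f x) = p x) (x y : M) : edist (f x) (f y) ≤ edist x y := by
  refine le_of_forall_gt fun r hr => ?_
  obtain ⟨c, hc, h0, h1, hl⟩ := exists_curve_of_edist_lt (E := E) hr
  have hinj : ∀ x, Function.Injective (mfderiv 𝓘(ℝ, E) 𝓘(ℝ, E) p x) := fun x => by
    rw [injective_iff_map_eq_zero]
    intro v hv
    rw [← norm_eq_zero, ← hp.2 x v, hv, norm_zero]
  have hpfc : p ∘ (f ∘ c) = p ∘ c := funext fun t => hpf (c t)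
  have hp1 : ContMDiff 𝓘(ℝ, E) 𝓘(ℝ, E) 1 p := hp.1.of_le (by exact_mod_cast le_top)
  have hfc : ContMDiff 𝓘(ℝ, ℝ) 𝓘(ℝ, E) 1 (f ∘ c) :=
    contMDiff_of_comp hp.1 hloc hinj (hf.comp hc.continuous) (hpfc ▸ hp1.comp hc)
  have hspeed : ∀ d : ℝ → M, ContMDiff 𝓘(ℝ, ℝ) 𝓘(ℝ, E) 1 d → ∀ t,
      ‖mfderiv 𝓘(ℝ, ℝ) 𝓘(ℝ, E) d t 1‖ₑ = ‖mfderiv 𝓘(ℝ, ℝ) 𝓘(ℝ, E) (p ∘ d) t 1‖ₑ := by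
    intro d hd t
    rw [mfderiv_comp t (hp1.mdifferentiableAt (by simp)) (hd.mdifferentiableAt (by simp)),
      ← ofReal_norm, ← ofReal_norm]
    exact congrArg _ (hp.2 (d t) _).symm
  -- Both curves project to the same curve under `p`, which preserves speeds.
  have hlen : pathELength 𝓘(ℝ, E) (f ∘ c) 0 1 = pathELength 𝓘(ℝ, E) c 0 1 := by
    simp only [pathELength_eq_lintegral_mfderiv_Icc]
    congr 1
    funext t
    rw [hspeed _ hfc, hspeed _ hc]
    rw [hpfc]
  calc edist (f x) (f y) = edist ((f ∘ c) 0) ((f ∘ c) 1) := by simp [h0, h1]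
    _ ≤ pathELength 𝓘(ℝ, E) (f ∘ c) 0 1 := edist_le_pathELength hfc zero_le_one
    _ < r := hlen ▸ hl

end Riemannian

/-! ### Deck transformations and properness of the universal cover -/

section Deck

/-- Being at finite distance is an equivalence relation with open classes, so a connected space is a
single class. -/
theorem edist_ne_top_of_preconnectedSpace {M : Type*} [EMetricSpace M] [PreconnectedSpace M]
    (x y : M) : edist x y ≠ ⊤ := by
  have h : Metric.eball x ⊤ = univ := by
    refine IsClopen.eq_univ ⟨?_, Metric.isOpen_eball⟩ ⟨x, Metric.mem_eball_self (by simp)⟩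
    rw [← isOpen_compl_iff, EMetric.isOpen_iff]
    intro z hz
    refine ⟨⊤, by simp, fun w hw hwx => hz ?_⟩
    rw [Metric.mem_eball] at hw hwx ⊢
    exact (edist_triangle_left z x w).trans_lt (ENNReal.add_lt_top.2 ⟨hw, hwx⟩)
  have hy : y ∈ Metric.eball x ⊤ := h ▸ mem_univ y
  exact (Metric.mem_eball'.1 hy).ne

/-- Simply connected coverings of connected spaces are regular. -/
theorem isRegularCovering_of_simplyConnectedSpace {X B : Type*} [TopologicalSpace X]
    [TopologicalSpace B] [SimplyConnectedSpace X] [LocallyPathConnectedSpace X]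
    [ConnectedSpace B] {p : X → B} (hp : IsCoveringMap p) : IsRegularCovering p := by
  have hsurj : Function.Surjective p := by
    rw [← range_eq_univ]
    refine IsClopen.eq_univ ⟨?_, hp.isOpenMap.isOpen_range⟩ (range_nonempty p)
    rw [← isOpen_compl_iff, isOpen_iff_mem_nhds]
    intro b hb
    -- Over an evenly covered set all fibres are modelled on that of `b`, so a single point of it in
    -- the range puts `b` in the range.
    obtain ⟨_, U, hbU, hU, hpU, Φ, hΦ⟩ := hp b
    refine mem_of_superset (hU.mem_nhds hbU) fun b' hb' hmem => hb ?_
    obtain ⟨x, rfl⟩ := hmem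
    exact ⟨(Φ ⟨x, hb'⟩).2.1, (Φ ⟨x, hb'⟩).2.2⟩
  have hlift : ∀ x y, p x = p y → ∃ F : C(X, X), F x = y ∧ p ∘ F = p := fun x y hxy =>
    (hp.existsUnique_continuousMap_lifts ⟨p, hp.continuous⟩ x y hxy.symm).exists
  have hinv : ∀ (F F' : C(X, X)) (x : X), F' (F x) = x → p ∘ F = p → p ∘ F' = p →
      Function.LeftInverse F' F := by
    intro F F' x hx hF hF'
    refine congrFun (hp.eq_of_comp_eq (g₁ := F' ∘ F) (g₂ := id)
      (F'.continuous.comp F.continuous) continuous_id ?_ x hx)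
    rw [← Function.comp_assoc, hF', hF, Function.comp_id]
  refine ⟨hp, hsurj, fun x y hxy => ?_⟩
  obtain ⟨F, hFx, hF⟩ := hlift x y hxy
  obtain ⟨F', hFy, hF'⟩ := hlift y x hxy.symm
  exact ⟨⟨⟨F, F', hinv F F' x (by rw [hFx, hFy]) hF hF', hinv F' F y (by rw [hFy, hFx]) hF' hF⟩,
    F.continuous, F'.continuous⟩, fun z => congrFun hF z, hFx⟩

/-- Closed balls are relatively compact in a length space with a cocompact group of isometries. -/
theorem exists_isCompact_closedEBall_subset {M B Γ : Type*} [EMetricSpace M] [TopologicalSpace B]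
    [T2Space B] [CompactSpace B] [LocallyCompactSpace M] [Group Γ] [MulAction Γ M] {p : M → B}
    (hp : IsQuotientCoveringMap p Γ)
    (hiso : ∀ (g : Γ) (x y : M), edist (g • x) (g • y) = edist x y)
    (hlen : ∀ (x y : M) (a b : ℝ≥0∞), a ≠ ⊤ → 0 < b → edist x y < a + b →
      ∃ z, edist x z ≤ a ∧ edist z y < b) (x : M) (r : ℝ≥0) :
    ∃ C : Set M, IsCompact C ∧ Metric.closedEBall x r ⊆ C := by
  have hcont := hp.toContinuousConstSMul
  obtain ⟨F, hF, hcov⟩ := exists_compact_interior_meets_orbits hp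
  -- A Lebesgue number on `F`, moved around by isometries, puts every `δ`-ball inside one translate
  -- of `F`.
  obtain ⟨δ, hδ, hleb⟩ := lebesgue_number_lemma_of_emetric hF
    (c := fun g : Γ => (g • ·) '' interior F)
    (fun g => (Homeomorph.smul g).isOpenMap _ isOpen_interior) fun z _ => by
      obtain ⟨g, y, hy, rfl⟩ := hcov z
      exact mem_iUnion.2 ⟨g, y, hy, rfl⟩
  have hleb' : ∀ z, ∃ g : Γ, Metric.eball z δ ⊆ (g • ·) '' F := by
    intro z
    obtain ⟨g, y, hy, rfl⟩ := hcov z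
    obtain ⟨h, hh⟩ := hleb y (interior_subset hy)
    refine ⟨g * h, fun w hw => ?_⟩
    have hw' : g⁻¹ • w ∈ Metric.eball y δ := by
      rw [Metric.mem_eball] at hw ⊢
      rwa [← hiso g, smul_inv_smul]
    obtain ⟨u, hu, huw⟩ := hh hw'
    refine ⟨u, interior_subset hu, ?_⟩
    simp only at huw
    simp only [mul_smul, huw, smul_inv_smul]
  obtain ⟨ε, hε0, hεδ⟩ := ENNReal.lt_iff_exists_nnreal_btwn.1 hδ
  have hε0' : 0 < ε := by exact_mod_cast hε0
  -- The radius grows by `ε / 2` so that a point of the next ball is strictly within `ε < δ` of the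
  -- previous one; finitely many translates of `F` meeting the old compact set then suffice.
  have hballs : ∀ k : ℕ, ∃ C : Set M, IsCompact C ∧ Metric.closedEBall x (k * (ε / 2 : ℝ≥0)) ⊆ C := by
    intro k
    induction k with
    | zero => exact ⟨{x}, isCompact_singleton, by simp⟩
    | succ k ih =>
      obtain ⟨C, hC, hCx⟩ := ih
      refine ⟨⋃ g ∈ {g : Γ | ∃ y ∈ F, g • y ∈ C}, (g • ·) '' F,
        (finite_setOf_smul_mem hp hF hC).isCompact_biUnion fun g _ =>
          hF.image (continuous_const_smul g), fun y hy => ?_⟩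
      rw [Metric.mem_closedEBall'] at hy
      have hlt : edist x y < k * (ε / 2 : ℝ≥0) + ε := by
        refine hy.trans_lt ?_
        have : ((k + 1 : ℕ) : ℝ≥0) * (ε / 2) < k * (ε / 2) + ε := by
          have := half_lt_self hε0'
          push_cast
          rw [add_mul, one_mul]
          gcongr
        exact_mod_cast this
      obtain ⟨z, hxz, hzy⟩ := hlen x y _ _ (by finiteness) hε0 hlt
      obtain ⟨g, hg⟩ := hleb' z
      obtain ⟨u, hu, huz⟩ := hg (Metric.mem_eball_self hδ)
      have huz' : g • u = z := huz
      have hyF := hg (Metric.mem_eball'.2 (hzy.trans hεδ))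
      exact mem_iUnion₂.2 ⟨g, ⟨u, hu, huz' ▸ hCx (Metric.mem_closedEBall'.2 hxz)⟩, hyF⟩
  obtain ⟨k, hk⟩ := exists_nat_ge (r / (ε / 2))
  obtain ⟨C, hC, hCx⟩ := hballs k
  refine ⟨C, hC, (Metric.closedEBall_subset_closedEBall ?_).trans hCx⟩
  have : r ≤ k * (ε / 2) := (div_le_iff₀ (half_pos hε0')).1 hk
  exact_mod_cast this

end Deck

end FillRad

/-! ### Application to the orbit of a subgroup of the fundamental group -/

theorem mainTheorem4 (n : ℕ)
    {N : Type*} [EMetricSpace N] [ChartedSpace (EuclideanSpace ℝ (Fin n)) N]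
    [IsManifold (𝓡 n) ∞ N]
    [RiemannianBundle (fun x : N => TangentSpace (𝓡 n) x)]
    [IsContMDiffRiemannianBundle (𝓡 n) ∞ (EuclideanSpace ℝ (Fin n))
      (fun x : N => TangentSpace (𝓡 n) x)]
    [IsRiemannianManifold (𝓡 n) N] [CompactSpace N] [ConnectedSpace N]
    {N' : Type*} [EMetricSpace N'] [ChartedSpace (EuclideanSpace ℝ (Fin n)) N']
    [IsManifold (𝓡 n) ∞ N']
    [RiemannianBundle (fun x : N' => TangentSpace (𝓡 n) x)]
    [IsContMDiffRiemannianBundle (𝓡 n) ∞ (EuclideanSpace ℝ (Fin n))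
      (fun x : N' => TangentSpace (𝓡 n) x)]
    [IsRiemannianManifold (𝓡 n) N'] [SimplyConnectedSpace N']
    (p : N' → N) (hp : IsCoveringMap p) (hiso : FillRad.IsLocalRiemannianIsometry (𝓡 n) p)
    (hfill : FillRad.HasBoundedFillRadius (𝓡 n) N')
    (x₀ : N) (G : Subgroup (FundamentalGroup N x₀)) (hG : G.FG) :
    ¬ FillRad.HasNumEnds G 1 := by
  intro hends
  have : Group.FG G := (Group.fg_iff_subgroup_fg G).2 hG
  obtain ⟨ℓ, hℓ⟩ := FillRad.exists_isWordLength (G := G)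
  obtain ⟨hinf, hone⟩ := hends.infinite_and_oneEnded hℓ
  have : LocallyPathConnectedSpace N' :=
    ChartedSpace.locallyPathConnectedSpace (EuclideanSpace ℝ (Fin n)) N'
  have : LocallyCompactSpace N' :=
    ChartedSpace.locallyCompactSpace (EuclideanSpace ℝ (Fin n)) N'
  have hreg := FillRad.isRegularCovering_of_simplyConnectedSpace hp
  have hq := FillRad.isQuotientCoveringMap_deckGroup hreg
  have hle : ∀ (g : FillRad.deckGroup p) (x y : N'), edist (g • x) (g • y) ≤ edist x y :=
    fun g x y => FillRad.edist_le_of_comp_eq hp.isLocalHomeomorph hiso g.1.continuous g.2 x y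
  have hdeck : ∀ (g : FillRad.deckGroup p) (x y : N'), edist (g • x) (g • y) = edist x y :=
    fun g x y => le_antisymm (hle g x y) (by simpa using hle g⁻¹ (g • x) (g • y))
  obtain ⟨e, he⟩ := hreg.2.1 x₀
  let Φ := hq.fundamentalGroupToMulOpposite (⟨e, he⟩ : p ⁻¹' {x₀})
  -- Monodromy lands in the opposite group; inversion makes the map multiplicative in the original
  -- order.
  let Ψ : G → FillRad.deckGroup p := fun g => (Φ g.1).unop⁻¹
  have hΨinj : Function.Injective Ψ := fun g h hgh => Subtype.ext
    (hq.fundamentalGroupToMulOpposite_injective _ (MulOpposite.unop_injective (inv_injective hgh)))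
  have hΨ : ∀ g h : G, Ψ (g⁻¹ * h) = (Ψ g)⁻¹ * Ψ h := fun g h => by
    have : Φ (g.1⁻¹ * h.1) = (Φ g.1)⁻¹ * Φ h.1 := by rw [map_mul, map_inv]
    change (Φ (g.1⁻¹ * h.1)).unop⁻¹ = _
    rw [this]
    simp [Ψ]
  have hdist : ∀ g h : G, edist (Ψ g • e) (Ψ h • e) = edist e (Ψ (g⁻¹ * h) • e) := fun g h => by
    rw [hΨ, ← hdeck (Ψ g) e, mul_smul, smul_inv_smul]
  obtain ⟨D, hD⟩ : ∃ D : ℝ≥0, ∀ g : G, ℓ g ≤ 1 → edist e (Ψ g • e) < D := by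
    obtain ⟨D, hD⟩ := ((hℓ.finite_ball 1).image fun g => (edist e (Ψ g • e)).toNNReal).bddAbove
    refine ⟨D + 1, fun g hg => ?_⟩
    have hfin := FillRad.edist_ne_top_of_preconnectedSpace e (Ψ g • e)
    have hlt : (edist e (Ψ g • e)).toNNReal < D + 1 :=
      (hD ⟨g, hg, rfl⟩).trans_lt (lt_add_one D)
    calc edist e (Ψ g • e) = (edist e (Ψ g • e)).toNNReal := (ENNReal.coe_toNNReal hfin).symm
      _ < (D + 1 : ℝ≥0) := ENNReal.coe_lt_coe.2 hlt
  refine FillRad.not_hasBoundedFillRadius hℓ hone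
    (FillRad.isPreconnected_eball (EuclideanSpace ℝ (Fin n))) (fun g => Ψ g • e) (D := D)
    (fun g h hgh => (hdist g h).trans_lt (hD _ hgh)) (fun r => ?_) hfill
  -- Properness of the orbit map: only finitely many deck transformations send `e` into a compact
  -- set containing the ball, and `Ψ` is injective.
  obtain ⟨C, hC, hCe⟩ := FillRad.exists_isCompact_closedEBall_subset hq hdeck
    (fun x y a b => FillRad.exists_edist_le_of_edist_lt_add (EuclideanSpace ℝ (Fin n))) e r
  have hfin := (FillRad.finite_setOf_smul_mem hq (isCompact_singleton (x := e)) hC).preimage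
    hΨinj.injOn
  obtain ⟨K, hK⟩ := (hfin.image ℓ).bddAbove
  refine ⟨K, fun g h hgh => hK ⟨_, ⟨e, rfl, hCe ?_⟩, rfl⟩⟩
  rw [Metric.mem_closedEBall', ← hdist]
  exact hgh.le
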